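/- Throughout, a coarse structure on a set $X$ is a family $\mathcal E$ of subsets of $X\times X$ (entourages) that contains the diagonal and is closed under subsets, inverses, finite unions and compositions. It is generated by a family $S\subseteq\mathcal P(X\times X)$ if it is the intersection of all coarse structures on $X$ containing $S$; $|\mathcal E|_{\min}$ denotes the least cardinality of a generating family. $(X,\mathcal E)$ is uniformly locally finite if $\sup_{x\in X}|\{y : (x,y)\in E\}|<\infty$ for all $E\in\mathcal E$. A metric space $(X,d)$ is given the bounded coarse structure, generated by the sets $\{(x,y): d(x,y)\le r\}$, $r\ge 0$. A map $f\colon (X,\mathcal E)\to (Y,\mathcal F)$ is coarse if for every $E\in\mathcal E$ there is $F\in\mathcal F$ such that $(x,x')\in E$ implies $(f(x),f(x'))\in F$. Two maps $f,g$ from a set $Z$ to $X$ are close if $\{(f(z),g(z)) : z\in Z\}\in\mathcal E$. A coarse map $f$ is a coarse equivalence if for every $F\in\mathcal F$ there is $E\in\mathcal E$ such that $(x,x')\notin E$ implies $(f(x),f(x'))\notin F$, and there is a coarse map $g\colon Y\to X$ with $g\circ f$ close to $\mathrm{id}_X$ and $f\circ g$ close to $\mathrm{id}_Y$. Let $\mathbb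 D=\{z\in\mathbb C: |z|\le 1\}$ and, for a set $J$, let $\mathrm{cov}(\mathbb D^J)$ be the least cardinality of a family of nowhere dense subsets of $\mathbb D^J$ (product topology) that covers $\mathbb D^J$ ($\infty$ if $J=\emptyset$). $(X,\mathcal E)$ is small if $\mathrm{cov}(\mathbb D^X)>|\mathcal E|_{\min}$. $(X,\mathcal E)$ admits a small partition if there is a partition $X=\bigsqcup_{i\in I}X_i$ such that, with $\mathcal E_\Delta=\{\bigsqcup_{i\in I}(X_i\times X_i)\cap E : E\in\mathcal E\}$, the coarse space $(X,\mathcal E_\Delta)$ is small and $\mathcal E$ is generated by $\mathcal E_\Delta\cup\{E\in\mathcal E : |E|<\infty\}$. The uniform Roe algebra $\mathrm C^*_u(X)$ is the operator norm closure in $B(\ell_2(X))$ of the algebra of all $T\in B(\ell_2(X))$ for which there is $E\in\mathcal E$ with $\langle T\delta_x,\delta_{x'}\rangle=0$ for all $(x,x')\notin E$. An operator $T\in\mathrm C^*_u(X)$ is a ghost if for every $\varepsilon>0$ there is a finite $A\subseteq X$ with $|\langle T\delta_x,\delta_{x'}\rangle|<\varepsilon$ for all $x,x'\in X\setminus A$.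 Isomorphisms of uniform Roe algebras are $*$-isomorphisms. **Corollary.** (1) Let $(X,\mathcal E)$ and $(Y,\mathcal F)$ be uniformly locally finite coarse spaces admitting small partitions, and suppose that all ghost projections in $\mathrm C^*_u(X)$ and in $\mathrm C^*_u(Y)$ are compact. If $\mathrm C^*_u(X)$ and $\mathrm C^*_u(Y)$ are isomorphic, then $(X,\mathcal E)$ and $(Y,\mathcal F)$ are coarsely equivalent. (2) In particular, let $(X,d)$ and $(Y,\partial)$ be uniformly locally finite metric spaces such that all ghost projections in $\mathrm C^*_u(X)$ and in $\mathrm C^*_u(Y)$ are compact. If $\mathrm C^*_u(X)$ and $\mathrm C^*_u(Y)$ are isomorphic, then $(X,d)$ and $(Y,\partial)$ are coarsely equivalent. -/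

import Mathlib

universe u v

noncomputable section

open scoped Cardinal ENNReal

/-! ## Coarse spaces -/

/-- A coarse structure on a set `X`: a family of subsets of `X × X` (the entourages) containing the
diagonal and closed under subsets, inverses, finite unions and compositions. -/
@[ext]
structure CoarseStructure (X : Type u) where
  entourages : Set (Set (X × X))
  diag_mem : {p : X × X | p.1 = p.2} ∈ entourages
  subset_mem : ∀ E ∈ entourages, ∀ F, F ⊆ E → F ∈ entourages
  inv_mem : ∀ E ∈ entourages, {p : X × X | (p.2, p.1) ∈ E} ∈ entourages
  union_mem : ∀ E ∈ entourages, ∀ F ∈ entourages, E ∪ F ∈ entourages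
  comp_mem : ∀ E ∈ entourages, ∀ F ∈ entourages,
    {p : X × X | ∃ z, (p.1, z) ∈ E ∧ (z, p.2) ∈ F} ∈ entourages

namespace CoarseStructure

variable {X : Type u} {Y : Type v}

/-- The coarse structure generated by a family `S` of subsets of `X × X`: the intersection of all
coarse structures that contain `S`. -/
def generate (S : Set (Set (X × X))) : CoarseStructure X where
  entourages := {E | ∀ 𝓔 : CoarseStructure X, S ⊆ 𝓔.entourages → E ∈ 𝓔.entourages}
  diag_mem := fun 𝓔 _ => 𝓔.diag_mem
  subset_mem := fun E hE F hF 𝓔 h => 𝓔.subset_mem E (hE 𝓔 h) F hF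
  inv_mem := fun E hE 𝓔 h => 𝓔.inv_mem E (hE 𝓔 h)
  union_mem := fun E hE F hF 𝓔 h => 𝓔.union_mem E (hE 𝓔 h) F (hF 𝓔 h)
  comp_mem := fun E hE F hF 𝓔 h => 𝓔.comp_mem E (hE 𝓔 h) F (hF 𝓔 h)

/-- The bounded coarse structure of a metric space, generated by the sets
`{(x, y) | d(x, y) ≤ r}`, `r ≥ 0`. -/
def bounded (X : Type u) [MetricSpace X] : CoarseStructure X :=
  generate {E | ∃ r : ℝ, 0 ≤ r ∧ E = {p : X × X | dist p.1 p.2 ≤ r}}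

/-- `sup_x |{y | (x, y) ∈ E}| < ∞` for every entourage `E`. -/
def UniformlyLocallyFinite (𝓔 : CoarseStructure X) : Prop :=
  ∀ E ∈ 𝓔.entourages, ∃ n : ℕ, ∀ x : X, {y : X | (x, y) ∈ E}.encard ≤ n

/-! ### Coarse maps and coarse equivalence -/

/-- Two maps into a coarse space are close. -/
def Close {Z : Type*} (𝓔 : CoarseStructure X) (f g : Z → X) : Prop :=
  {p : X × X | ∃ z, p = (f z, g z)} ∈ 𝓔.entourages

def IsCoarseMap (𝓔 : CoarseStructure X) (𝓕 : CoarseStructure Y) (f : X → Y) : Prop :=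
  ∀ E ∈ 𝓔.entourages, ∃ F ∈ 𝓕.entourages, ∀ x x' : X, (x, x') ∈ E → (f x, f x') ∈ F

def IsCoarseEmbedding (𝓔 : CoarseStructure X) (𝓕 : CoarseStructure Y) (f : X → Y) : Prop :=
  IsCoarseMap 𝓔 𝓕 f ∧
    ∀ F ∈ 𝓕.entourages, ∃ E ∈ 𝓔.entourages, ∀ x x' : X, (x, x') ∉ E → (f x, f x') ∉ F

def IsCoarseEquivalence (𝓔 : CoarseStructure X) (𝓕 : CoarseStructure Y) (f : X → Y) : Prop :=
  IsCoarseEmbedding 𝓔 𝓕 f ∧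
    ∃ g : Y → X, IsCoarseMap 𝓕 𝓔 g ∧ Close 𝓔 (g ∘ f) id ∧ Close 𝓕 (f ∘ g) id

/-- The two coarse spaces are coarsely equivalent. -/
def CoarselyEquivalent (𝓔 : CoarseStructure X) (𝓕 : CoarseStructure Y) : Prop :=
  ∃ f : X → Y, IsCoarseEquivalence 𝓔 𝓕 f

/-! ### Small coarse spaces and small partitions -/

/-- The closed unit disk `{z ∈ ℂ | |z| ≤ 1}`. -/
abbrev Disk : Type := {z : ℂ // ‖z‖ ≤ 1}

/-- `cov(𝔻^J)`: the minimal cardinality of a family of nowhere dense subsets of `𝔻^J` (with the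
product topology) that covers `𝔻^J`. For nonempty `J` this is an honest cardinal; for empty `J` the
space is a single point, no such family exists and the value is `⊤`. -/
def cov (J : Type u) : WithTop Cardinal.{u} :=
  sInf {c | ∃ 𝓤 : Set (Set (J → Disk)),
    (∀ N ∈ 𝓤, IsNowhereDense N) ∧ ⋃₀ 𝓤 = Set.univ ∧ c = ((#𝓤 : Cardinal.{u}) : WithTop Cardinal.{u})}

/-- The minimal cardinality of a set of generators of the coarse structure. -/
def minGenerators (𝓔 : CoarseStructure X) : Cardinal.{u} :=
  sInf {c | ∃ S : Set (Set (X × X)), generate S = 𝓔 ∧ c = #S}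

/-- A coarse space `X` is small if `cov(𝔻^X)` exceeds the minimal cardinality of a set of
generators. -/
def IsSmall (𝓔 : CoarseStructure X) : Prop :=
  (𝓔.minGenerators : WithTop Cardinal.{u}) < cov X

/-- For a partition `X = ⨆ X_i`, given as an equivalence relation, the coarse structure
`{⨆ (X_i × X_i) ∩ E | E ∈ 𝓔}`. -/
def blockDiagonal (𝓔 : CoarseStructure X) (r : Setoid X) : CoarseStructure X where
  entourages := {D | ∃ E ∈ 𝓔.entourages, D = {p : X × X | r p.1 p.2} ∩ E}
  diag_mem := ⟨_, 𝓔.diag_mem, by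
    ext ⟨x, y⟩
    simp only [Set.mem_ofPred_eq, Set.mem_inter_iff]
    exact ⟨fun h => ⟨h ▸ r.refl x, h⟩, fun h => h.2⟩⟩
  subset_mem := by
    rintro _ ⟨E, hE, rfl⟩ F hF
    refine ⟨F, 𝓔.subset_mem E hE F (hF.trans Set.inter_subset_right), ?_⟩
    exact (Set.inter_eq_right.2 (hF.trans Set.inter_subset_left)).symm
  inv_mem := by
    rintro _ ⟨E, hE, rfl⟩
    refine ⟨_, 𝓔.inv_mem E hE, ?_⟩
    ext ⟨x, y⟩
    simp only [Set.mem_ofPred_eq, Set.mem_inter_iff]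
    exact and_congr_left fun _ => ⟨r.symm, r.symm⟩
  union_mem := by
    rintro _ ⟨E, hE, rfl⟩ _ ⟨F, hF, rfl⟩
    exact ⟨_, 𝓔.union_mem E hE F hF, (Set.inter_union_distrib_left _ _ _).symm⟩
  comp_mem := by
    rintro _ ⟨E, hE, rfl⟩ _ ⟨F, hF, rfl⟩
    refine ⟨_, 𝓔.subset_mem _ (𝓔.comp_mem E hE F hF)
      {p : X × X | ∃ z, (p.1, z) ∈ {p : X × X | r p.1 p.2} ∩ E ∧
        (z, p.2) ∈ {p : X × X | r p.1 p.2} ∩ F} ?_, ?_⟩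
    · rintro ⟨x, y⟩ ⟨z, h₁, h₂⟩
      exact ⟨z, h₁.2, h₂.2⟩
    · symm
      refine Set.inter_eq_right.2 ?_
      rintro ⟨x, y⟩ ⟨z, h₁, h₂⟩
      exact r.trans h₁.1 h₂.1

/-- `X` has a small partition: for some partition, the block-diagonal coarse structure is small and,
together with the finite entourages, generates the given coarse structure. -/
def HasSmallPartition (𝓔 : CoarseStructure X) : Prop :=
  ∃ r : Setoid X, (𝓔.blockDiagonal r).IsSmall ∧
    generate ((𝓔.blockDiagonal r).entourages ∪ {E | E ∈ 𝓔.entourages ∧ E.Finite}) = 𝓔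

end CoarseStructure

/-! ## Uniform Roe algebras -/

/-- The Hilbert space `ℓ₂(X)`. -/
abbrev EllTwo (X : Type u) : Type u := lp (fun _ : X => ℂ) 2

open Classical in
/-- The standard basis vector `δ_x` of `ℓ₂(X)`. -/
def delta {X : Type u} (x : X) : EllTwo X := lp.single 2 x (1 : ℂ)

/-- The matrix coefficient `⟨T δ_x, δ_x'⟩` (the inner product of Mathlib is linear in its second
argument). -/
def coeff {X : Type u} (T : EllTwo X →L[ℂ] EllTwo X) (x x' : X) : ℂ :=
  inner ℂ (delta x') (T (delta x))

theorem inner_delta {X : Type u} (x : X) (f : EllTwo X) : inner ℂ (delta x) f = f x := by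
  classical
  unfold delta
  rw [lp.inner_single_left]
  simp

theorem coeff_star {X : Type u} (T : EllTwo X →L[ℂ] EllTwo X) (x x' : X) :
    coeff (star T) x x' = star (coeff T x' x) := by
  unfold coeff
  rw [ContinuousLinearMap.star_eq_adjoint, ContinuousLinearMap.adjoint_inner_right]
  exact (inner_conj_symm _ _).symm

theorem exists_of_coeff_mul_ne_zero {X : Type u} (S T : EllTwo X →L[ℂ] EllTwo X) (x x' : X)
    (h : coeff (S * T) x x' ≠ 0) : ∃ z, coeff T x z ≠ 0 ∧ coeff S z x' ≠ 0 := by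
  by_contra hc
  push Not at hc
  apply h
  have h1 : coeff (S * T) x x' = inner ℂ ((star S) (delta x')) (T (delta x)) := by
    unfold coeff
    rw [ContinuousLinearMap.star_eq_adjoint, ContinuousLinearMap.adjoint_inner_left]
    rfl
  rw [h1, lp.inner_eq_tsum]
  convert tsum_zero with z
  by_cases hz : coeff T x z = 0
  · rw [coeff, inner_delta] at hz
    rw [hz, inner_zero_right]
  · have h2 := coeff_star S x' z
    rw [hc z hz, star_zero, coeff, inner_delta] at h2
    rw [h2, inner_zero_left]

namespace CoarseStructure

variable {X : Type u}

/-- The algebraic uniform Roe algebra `C*_u[X]`: the bounded operators `T` on `ℓ₂(X)` for which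
there is an entourage `E` with `⟨T δ_x, δ_x'⟩ = 0` for all `(x, x') ∉ E`. -/
def algUniformRoeAlgebra (𝓔 : CoarseStructure X) :
    StarSubalgebra ℂ (EllTwo X →L[ℂ] EllTwo X) where
  carrier := {T | ∃ E ∈ 𝓔.entourages, ∀ x x' : X, (x, x') ∉ E → coeff T x x' = 0}
  mul_mem' := by
    rintro S T ⟨E, hE, hS⟩ ⟨F, hF, hT⟩
    refine ⟨_, 𝓔.comp_mem F hF E hE, fun x x' hx => ?_⟩
    by_contra h
    obtain ⟨z, hz₁, hz₂⟩ := exists_of_coeff_mul_ne_zero S T x x' h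
    exact hx ⟨z, by_contra fun h' => hz₁ (hT _ _ h'), by_contra fun h' => hz₂ (hS _ _ h')⟩
  add_mem' := by
    rintro S T ⟨E, hE, hS⟩ ⟨F, hF, hT⟩
    refine ⟨_, 𝓔.union_mem E hE F hF, fun x x' hx => ?_⟩
    have h₁ := hS x x' fun h => hx (Or.inl h)
    have h₂ := hT x x' fun h => hx (Or.inr h)
    unfold coeff at *
    rw [add_apply, inner_add_right, h₁, h₂, add_zero]
  algebraMap_mem' := by
    intro c
    refine ⟨_, 𝓔.diag_mem, fun x x' hx => ?_⟩
    have hx' : x' ≠ x := fun h => hx h.symm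
    classical
    have h1 : (algebraMap ℂ (EllTwo X →L[ℂ] EllTwo X) c) (delta x) = c • delta x := rfl
    rw [coeff, h1, inner_smul_right, inner_delta, delta, lp.single_apply_ne _ _ _ hx', mul_zero]
  star_mem' := by
    rintro T ⟨E, hE, hT⟩
    refine ⟨_, 𝓔.inv_mem E hE, fun x x' hx => ?_⟩
    rw [coeff_star, hT x' x hx, star_zero]

/-- The uniform Roe algebra `C*_u(X)`: the operator norm closure of `C*_u[X]` in `B(ℓ₂(X))`. -/
def uniformRoeAlgebra (𝓔 : CoarseStructure X) : StarSubalgebra ℂ (EllTwo X →L[ℂ] EllTwo X) :=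
  𝓔.algUniformRoeAlgebra.topologicalClosure

end CoarseStructure

/-- The ghost condition: for every `ε > 0` there is a finite `A ⊆ X` with `|⟨T δ_x, δ_x'⟩| < ε` for
all `x, x' ∉ A`. -/
def IsGhost {X : Type u} (T : EllTwo X →L[ℂ] EllTwo X) : Prop :=
  ∀ ε : ℝ, 0 < ε → ∃ A : Set X, A.Finite ∧ ∀ x x' : X, x ∉ A → x' ∉ A → ‖coeff T x x'‖ < ε

/-- All ghost projections in the uniform Roe algebra are compact operators. -/
def CoarseStructure.GhostProjectionsCompact {X : Type u} (𝓔 : CoarseStructure X) : Prop :=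
  ∀ P ∈ 𝓔.uniformRoeAlgebra, IsStarProjection P → IsGhost P → IsCompactOperator P

end

noncomputable section

open scoped Cardinal ENNReal

namespace CoarseStructure

variable {X : Type u} {Y : Type v}

/-! ### Generating families -/

/-! An isomorphism `Φ` sends each minimal projection onto `δ_x` to a rank one projection, onto a
unit vector ξ_x = `vec Φ x` of `ℓ₂(Y)`. Doing the same for `Φ.symm` yields vectors η_y with |η_y(x)|
= |ξ_x(y)| (`norm_vec_symm`), so that Σ_x |ξ_x(y)|² = 1 for every y and the ξ_x form a Hilbert
basis. The image of a multiplication operator is therefore diagonal in this basis, and its matrix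
coefficients are absolutely convergent series.

Compactness of ghost projections gives δ > 0 such that every ξ_x has a coordinate of modulus at
least δ, and likewise every η_y (`exists_lower_bound_of_ghostProjectionsCompact`). Choosing such
coordinates gives the maps f and g. Call x and y related if |ξ_x(y)| ≥ δ; this relation is symmetric
under exchanging `Φ` and `Φ.symm`. Everything then follows once the relation carries entourages to
entourages in both directions (`near_mem`).

After a finite colouring this reduces to injective families (`range_mem_of_injective`), where a
Baire category argument applies. A partial translation V moves δ_{x_i} to δ_{x'_i}. If the pairs
(y_i, y'_i) escaped every entourage, a generic multiplier a ∈ 𝔻^Y, transplanted to X, would make the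
entry of Φ(V m_a) at (y_i, y'_i) large for some i outside each chain of generators and arbitrarily
far out. This contradicts Φ(V m_a) ∈ C*_u(Y). Smallness of the partition says exactly that all these
genericity conditions can be met at once. -/

theorem subset_generate (S : Set (Set (X × X))) : S ⊆ (generate S).entourages :=
  fun _ hE _ h => h hE

theorem generate_subset {S : Set (Set (X × X))} {𝓔 : CoarseStructure X} (h : S ⊆ 𝓔.entourages) :
    (generate S).entourages ⊆ 𝓔.entourages :=
  fun _ hE => hE 𝓔 h

theorem generate_entourages (𝓔 : CoarseStructure X) : generate 𝓔.entourages = 𝓔 :=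
  CoarseStructure.ext (Set.Subset.antisymm (generate_subset subset_rfl) (subset_generate _))

/-- Chains of points in which the consecutive pairs lie in the reflexive symmetric closures of the
members of a list. -/
def Chain : List (Set (X × X)) → X → X → Prop
  | [], x, y => x = y
  | s :: L, x, y => ∃ z, (x = z ∨ (x, z) ∈ s ∨ (z, x) ∈ s) ∧ Chain L z y

theorem chain_refl (L : List (Set (X × X))) (x : X) : Chain L x x := by
  induction L with
  | nil => rfl
  | cons s L ih => exact ⟨x, Or.inl rfl, ih⟩

theorem chain_append (L M : List (Set (X × X))) (x y : X) :
    Chain (L ++ M) x y ↔ ∃ z, Chain L x z ∧ Chain M z y := by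
  induction L generalizing x with
  | nil => simp [Chain]
  | cons s L ih =>
    simp only [List.cons_append, Chain, ih]
    constructor
    · rintro ⟨z, h, w, h₁, h₂⟩
      exact ⟨w, ⟨z, h, h₁⟩, h₂⟩
    · rintro ⟨w, ⟨z, h, h₁⟩, h₂⟩
      exact ⟨z, h, w, h₁, h₂⟩

theorem Chain.reverse {L : List (Set (X × X))} {x y : X} (h : Chain L x y) :
    Chain L.reverse y x := by
  induction L generalizing x with
  | nil => exact Eq.symm h
  | cons s L ih =>
    obtain ⟨z, h₁, h₂⟩ := h
    rw [List.reverse_cons, chain_append]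
    exact ⟨z, ih h₂, x, h₁.elim (fun h => Or.inl h.symm) (fun h => Or.inr h.symm), rfl⟩

/-- Every entourage of a generated coarse structure consists of endpoints of chains along one finite
list of generators. -/
theorem exists_chain_of_mem_generate {S : Set (Set (X × X))} {E : Set (X × X)}
    (hE : E ∈ (generate S).entourages) :
    ∃ L : List S, ∀ x y, (x, y) ∈ E → Chain (L.map Subtype.val) x y := by
  -- Concatenation of lists serves both unions, since steps may be trivial, and compositions;
  -- reversal serves inverses, since steps are symmetric.
  let 𝓖 : CoarseStructure X :=
    { entourages := {E | ∃ L : List S, ∀ x y, (x, y) ∈ E → Chain (L.map Subtype.val) x y}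
      diag_mem := ⟨[], fun _ _ h => h⟩
      subset_mem := fun _ ⟨L, hL⟩ _ hF => ⟨L, fun x y h => hL x y (hF h)⟩
      inv_mem := fun _ ⟨L, hL⟩ => ⟨L.reverse, fun x y h => by
        rw [List.map_reverse]
        exact (hL y x h).reverse⟩
      union_mem := by
        rintro E ⟨L, hL⟩ F ⟨M, hM⟩
        refine ⟨L ++ M, fun x y h => ?_⟩
        rw [List.map_append, chain_append]
        rcases h with h | h
        · exact ⟨y, hL x y h, chain_refl _ _⟩
        · exact ⟨x, chain_refl _ _, hM x y h⟩
      comp_mem := by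
        rintro E ⟨L, hL⟩ F ⟨M, hM⟩
        refine ⟨L ++ M, fun x y ⟨z, h₁, h₂⟩ => ?_⟩
        rw [List.map_append, chain_append]
        exact ⟨z, hL _ _ h₁, hM _ _ h₂⟩ }
  refine hE 𝓖 fun s hs => ⟨[⟨s, hs⟩], fun x y h => ⟨y, Or.inr (Or.inl h), rfl⟩⟩

theorem chain_mem {𝓔 : CoarseStructure X} {L : List (Set (X × X))}
    (hL : ∀ s ∈ L, s ∈ 𝓔.entourages) : {p : X × X | Chain L p.1 p.2} ∈ 𝓔.entourages := by
  induction L with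
  | nil => exact 𝓔.diag_mem
  | cons s L ih =>
    have h₁ := hL s (by simp)
    have h₂ := 𝓔.union_mem _ 𝓔.diag_mem _ (𝓔.union_mem _ h₁ _ (𝓔.inv_mem _ h₁))
    exact 𝓔.comp_mem _ h₂ _ (ih fun t ht => hL t (by simp [ht]))

theorem exists_generators (𝓔 : CoarseStructure X) :
    ∃ S : Set (Set (X × X)), generate S = 𝓔 ∧ 𝓔.minGenerators = #S :=
  csInf_mem (s := {c : Cardinal.{u} | ∃ S : Set (Set (X × X)), generate S = 𝓔 ∧ c = #S})
    ⟨_, 𝓔.entourages, 𝓔.generate_entourages, rfl⟩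

/-! ### Baire category -/

theorem compactSpace_disk : CompactSpace Disk := by
  have h : IsCompact {z : ℂ | ‖z‖ ≤ 1} := by
    convert! isCompact_closedBall (0 : ℂ) 1
    ext
    simp
  exact isCompact_iff_compactSpace.1 h

/-- The finite lists of generators number up to `max ℵ₀ κ`, not κ. If κ ≤ ℵ₀ the classical Baire
theorem in the compact Hausdorff space `X → Disk` suffices; otherwise the complements are too few
nowhere dense sets to cover. -/
theorem iInter_nonempty_of_card_lt_cov {κ : Cardinal.{u}}
    (hκ : (κ : WithTop Cardinal.{u}) < cov X) {ι : Type u} (hι : #ι ≤ max ℵ₀ κ)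
    (U : ι → Set (X → Disk)) (hU : ∀ i, IsOpen (U i)) (hd : ∀ i, Dense (U i)) :
    (⋂ i, U i).Nonempty := by
  rcases le_total κ ℵ₀ with h | h
  · rw [max_eq_left h, Cardinal.mk_le_aleph0_iff] at hι
    have := compactSpace_disk
    have : Nonempty Disk := ⟨⟨0, by simp⟩⟩
    exact (dense_iInter_of_isOpen hU hd).nonempty
  · rw [max_eq_right h] at hι
    by_contra hne
    rw [Set.not_nonempty_iff_eq_empty] at hne
    have hle : cov X ≤ ((#(Set.range fun i => (U i)ᶜ) : Cardinal.{u}) : WithTop Cardinal.{u}) := by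
      refine sInf_le ⟨_, ?_, ?_, rfl⟩
      · rintro _ ⟨i, rfl⟩
        rw [(hU i).isClosed_compl.isNowhereDense_iff, interior_compl, (hd i).closure_eq,
          Set.compl_univ]
      · rw [Set.sUnion_range, ← Set.compl_iInter, hne, Set.compl_empty]
    have h' := (hκ.trans_le hle)
    rw [WithTop.coe_lt_coe] at h'
    exact absurd (Cardinal.mk_range_le.trans hι) (not_le.2 h')

theorem aleph0_lt_cov (X : Type u) : ((ℵ₀ : Cardinal.{u}) : WithTop Cardinal.{u}) < cov X := by
  have h : ((Order.succ ℵ₀ : Cardinal.{u}) : WithTop Cardinal.{u}) ≤ cov X := by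
    refine le_sInf ?_
    rintro _ ⟨𝓤, h𝓤, hcov, rfl⟩
    rw [WithTop.coe_le_coe, Order.succ_le_iff]
    by_contra! hc
    rw [Cardinal.mk_le_aleph0_iff] at hc
    have := compactSpace_disk
    have : Nonempty Disk := ⟨⟨0, by simp⟩⟩
    refine not_isMeagre_of_isOpen (X := X → Disk) isOpen_univ Set.univ_nonempty ?_
    rw [← hcov, Set.sUnion_eq_biUnion]
    exact isMeagre_biUnion hc fun N hN => (h𝓤 N hN).isMeagre
  exact (WithTop.coe_lt_coe.2 (Order.lt_succ _)).trans_le h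

/-! ### Small partitions -/

/-- Entourages with finite off-block part form a coarse structure containing the generators.
Composition is the only delicate closure: an off-block composite has an off-block factor, finite in
number, and local finiteness leaves finitely many continuations. -/
theorem finite_diff_of_generate {𝓔 : CoarseStructure X} (hulf : 𝓔.UniformlyLocallyFinite)
    {r : Setoid X} (hr : generate ((𝓔.blockDiagonal r).entourages ∪
      {E | E ∈ 𝓔.entourages ∧ E.Finite}) = 𝓔) {E : Set (X × X)} (hE : E ∈ 𝓔.entourages) :
    {p ∈ E | ¬ r p.1 p.2}.Finite := by
  have hfin : ∀ F ∈ 𝓔.entourages, ∀ x, {y | (x, y) ∈ F}.Finite := fun F hF x => by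
    obtain ⟨n, hn⟩ := hulf F hF
    exact Set.finite_of_encard_le_coe (hn x)
  let 𝓖 : CoarseStructure X :=
    { entourages := {E | E ∈ 𝓔.entourages ∧ {p ∈ E | ¬ r p.1 p.2}.Finite}
      diag_mem := ⟨𝓔.diag_mem, by
        convert! Set.finite_empty
        ext ⟨x, y⟩
        simp only [Set.mem_ofPred_eq, Set.mem_empty_iff_false, iff_false, not_and, not_not]
        rintro rfl
        exact r.refl _⟩
      subset_mem := fun E hE F hF => ⟨𝓔.subset_mem E hE.1 F hF,
        hE.2.subset fun p hp => ⟨hF hp.1, hp.2⟩⟩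
      inv_mem := fun E hE => ⟨𝓔.inv_mem E hE.1, (hE.2.image Prod.swap).subset
        fun p hp => ⟨p.swap, ⟨hp.1, fun h => hp.2 (r.symm h)⟩, rfl⟩⟩
      union_mem := fun E hE F hF => ⟨𝓔.union_mem E hE.1 F hF.1, (hE.2.union hF.2).subset
        fun p hp => hp.1.elim (fun h => Or.inl ⟨h, hp.2⟩) (fun h => Or.inr ⟨h, hp.2⟩)⟩
      comp_mem := fun E hE F hF => ⟨𝓔.comp_mem E hE.1 F hF.1, by
        have h₁ : (⋃ q ∈ {p ∈ E | ¬ r p.1 p.2}, (fun y => (q.1, y)) '' {y | (q.2, y) ∈ F}).Finite :=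
          hE.2.biUnion fun q _ => (hfin F hF.1 q.2).image _
        have h₂ : (⋃ q ∈ {p ∈ F | ¬ r p.1 p.2}, (fun x => (x, q.2)) '' {x | (x, q.1) ∈ E}).Finite :=
          hF.2.biUnion fun q _ => (hfin _ (𝓔.inv_mem E hE.1) q.1).image _
        refine (h₁.union h₂).subset ?_
        rintro ⟨x, y⟩ ⟨⟨z, hxz, hzy⟩, hxy⟩
        by_cases h : r x z
        · exact Set.mem_union_right _ (Set.mem_iUnion₂.2
            ⟨(z, y), ⟨hzy, fun h' => hxy (r.trans h h')⟩, x, hxz, rfl⟩)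
        · exact Set.mem_union_left _ (Set.mem_iUnion₂.2 ⟨(x, z), ⟨hxz, h⟩, y, hzy, rfl⟩)⟩ }
  rw [← hr] at hE
  refine (generate_subset (𝓔 := 𝓖) ?_ hE).2
  rintro F (⟨F, hF, rfl⟩ | ⟨hF, hfin⟩)
  · refine ⟨𝓔.subset_mem F hF _ Set.inter_subset_right, ?_⟩
    convert! Set.finite_empty
    ext p
    simp only [Set.mem_ofPred_eq, Set.mem_inter_iff, Set.mem_empty_iff_false, iff_false, not_and,
      not_not]
    exact fun h => h.1
  · exact ⟨hF, hfin.subset fun p hp => hp.1⟩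

/-- The partition into one block works: the integer radii give countably many generators, and `cov`
is uncountable by Baire. -/
theorem hasSmallPartition_bounded (X : Type u) [MetricSpace X] :
    (bounded X).HasSmallPartition := by
  have htop : (bounded X).blockDiagonal ⊤ = bounded X := by
    apply CoarseStructure.ext
    have h : {p : X × X | (⊤ : Setoid X) p.1 p.2} = Set.univ := by
      ext; simp [Setoid.top_def]
    ext E
    constructor
    · rintro ⟨F, hF, rfl⟩
      exact (bounded X).subset_mem F hF _ Set.inter_subset_right
    · intro hE
      exact ⟨E, hE, by rw [h, Set.univ_inter]⟩
  refine ⟨⊤, ?_, ?_⟩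
  · rw [htop]
    refine lt_of_le_of_lt ?_ (aleph0_lt_cov X)
    rw [WithTop.coe_le_coe]
    refine le_trans (csInf_le' ⟨Set.range fun n : ℕ => {p : X × X | dist p.1 p.2 ≤ n}, ?_, rfl⟩)
      (Cardinal.mk_le_aleph0_iff.2 (Set.countable_range _))
    refine CoarseStructure.ext (Set.Subset.antisymm (generate_subset ?_) (generate_subset ?_))
    · rintro _ ⟨n, rfl⟩
      exact subset_generate _ ⟨n, n.cast_nonneg, rfl⟩
    · rintro _ ⟨r, -, rfl⟩
      obtain ⟨n, hn⟩ := exists_nat_ge r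
      exact CoarseStructure.subset_mem _ _ (subset_generate _ (Set.mem_range_self n)) _
        fun p hp => le_trans hp hn
  · rw [htop, Set.union_eq_left.2 fun E hE => hE.1, generate_entourages]

end CoarseStructure

/-! ### Colourings of maps with bounded fibres -/

theorem exists_colouring {Q Z : Type*} (g : Q → Z) (N : ℕ)
    (hg : ∀ z, {q | g q = z}.encard ≤ N) :
    ∃ (n : ℕ) (c : Q → Fin n), ∀ q q', c q = c q' → g q = g q' → q = q' := by
  -- Each fibre gets its own injective colouring; the extra colour keeps the palette nonempty.
  have h : ∀ z, ∃ c : Q → Fin (N + 1), Set.InjOn c {q | g q = z} := fun z => by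
    have hf : {q | g q = z}.Finite := Set.finite_of_encard_le_coe (hg z)
    refine hf.exists_injOn_of_encard_le (t := Set.univ) ?_ |>.imp fun c hc => hc.2
    refine (hg z).trans ?_
    rw [Set.encard_univ, ENat.card_eq_coe_fintype_card, Fintype.card_fin]
    exact_mod_cast Nat.le_succ N
  choose c hc using h
  refine ⟨N + 1, fun q => c (g q) q, fun q q' hqq' hg' => hc (g q) rfl hg'.symm ?_⟩
  simpa [hg'] using hqq'

/-! ### Operators on `ℓ₂` -/

section Operators

variable {X : Type u} {Y : Type v}

theorem delta_apply_self (x : X) : (delta x : EllTwo X) x = 1 := by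
  classical
  unfold delta
  exact lp.single_apply_self _ _ _

theorem delta_apply_ne {x z : X} (h : z ≠ x) : (delta x : EllTwo X) z = 0 := by
  classical
  unfold delta
  exact lp.single_apply_ne _ _ _ h

theorem norm_delta (x : X) : ‖delta x‖ = 1 := by
  classical
  unfold delta
  rw [lp.norm_single (by norm_num), norm_one]

theorem coeff_eq (T : EllTwo X →L[ℂ] EllTwo X) (x x' : X) : coeff T x x' = T (delta x) x' :=
  inner_delta _ _

theorem norm_coeff_le (T : EllTwo X →L[ℂ] EllTwo X) (x x' : X) : ‖coeff T x x'‖ ≤ ‖T‖ := by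
  refine (norm_inner_le_norm _ _).trans ?_
  rw [norm_delta, one_mul]
  exact (T.le_opNorm _).trans (by rw [norm_delta, mul_one])

theorem hasSum_norm_sq (f : EllTwo X) : HasSum (fun x => ‖f x‖ ^ 2) (‖f‖ ^ 2) := by
  have h := lp.hasSum_norm (p := 2) (by norm_num) f
  simpa using h

theorem tendsto_norm_apply_cofinite (f : EllTwo X) :
    Filter.Tendsto (fun x => ‖f x‖ ^ 2) Filter.cofinite (nhds 0) :=
  (hasSum_norm_sq f).summable.tendsto_cofinite_zero

theorem exists_apply_ne_zero {f : EllTwo X} (hf : f ≠ 0) : ∃ x, f x ≠ 0 := by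
  by_contra! h
  exact hf (lp.ext (funext h))

theorem eq_zero_of_forall_delta {T : EllTwo X →L[ℂ] EllTwo X} (h : ∀ x, T (delta x) = 0) :
    T = 0 := by
  classical
  ext1 f
  have h₁ := (lp.hasSum_single (p := 2) (by norm_num) f).mapL T
  have h₂ : ∀ x, T (lp.single 2 x (f x)) = 0 := fun x => by
    have : lp.single 2 x (f x) = f x • delta x := by
      unfold delta
      rw [← lp.single_smul]
      simp
    rw [this, map_smul, h, smul_zero]
  simp only [h₂] at h₁
  exact h₁.unique hasSum_zero

/-- Bounded operators of the form `(W f) z = a z * f (s z)`. -/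
theorem exists_weighted_composition (a : X → ℂ) (s : X → X) (ha : ∀ z, ‖a z‖ ≤ 1)
    (hs : ∀ z z', a z ≠ 0 → a z' ≠ 0 → s z = s z' → z = z') :
    ∃ W : EllTwo X →L[ℂ] EllTwo X, ∀ f z, W f z = a z * f (s z) := by
  classical
  have hsum : ∀ (f : EllTwo X) (F : Finset X),
      ∑ z ∈ F, ‖a z * f (s z)‖ ^ (2 : ℝ≥0∞).toReal ≤ ‖f‖ ^ (2 : ℝ≥0∞).toReal := fun f F => by
    calc ∑ z ∈ F, ‖a z * f (s z)‖ ^ (2 : ℝ≥0∞).toReal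
        = ∑ z ∈ F with a z ≠ 0, ‖a z * f (s z)‖ ^ (2 : ℝ≥0∞).toReal := by
          refine (Finset.sum_filter_of_ne fun z _ h => ?_).symm
          contrapose! h
          simp [h]
      _ ≤ ∑ z ∈ F with a z ≠ 0, ‖f (s z)‖ ^ (2 : ℝ≥0∞).toReal := by
          refine Finset.sum_le_sum fun z _ => ?_
          refine Real.rpow_le_rpow (norm_nonneg _) ?_ (by norm_num)
          rw [norm_mul]
          exact mul_le_of_le_one_left (norm_nonneg _) (ha z)
      _ = ∑ w ∈ ({z ∈ F | a z ≠ 0}).image s, ‖f w‖ ^ (2 : ℝ≥0∞).toReal := by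
          rw [Finset.sum_image]
          intro z hz z' hz' h
          simp only [Finset.coe_filter, Set.mem_ofPred_eq] at hz hz'
          exact hs z z' hz.2 hz'.2 h
      _ ≤ ‖f‖ ^ (2 : ℝ≥0∞).toReal := lp.sum_rpow_le_norm_rpow (by norm_num) f _
  refine ⟨LinearMap.mkContinuous
    { toFun := fun f => (⟨fun z => a z * f (s z), memℓp_gen' (hsum f)⟩ : EllTwo X)
      map_add' := fun f g => lp.ext (funext fun z => mul_add _ _ _)
      map_smul' := fun c f => lp.ext (funext fun z => mul_left_comm _ _ _) } 1 fun f => ?_,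
    fun f z => rfl⟩
  rw [one_mul]
  exact lp.norm_le_of_forall_sum_le (by norm_num) (norm_nonneg f) (hsum f)

/-- Multiplication by a function bounded by one. -/
def mulOp (a : X → ℂ) (ha : ∀ z, ‖a z‖ ≤ 1) : EllTwo X →L[ℂ] EllTwo X :=
  (exists_weighted_composition a id ha fun _ _ _ _ h => h).choose

theorem mulOp_apply (a : X → ℂ) (ha : ∀ z, ‖a z‖ ≤ 1) (f : EllTwo X) (z : X) :
    mulOp a ha f z = a z * f z :=
  (exists_weighted_composition a id ha fun _ _ _ _ h => h).choose_spec f z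

theorem mulOp_delta (a : X → ℂ) (ha : ∀ z, ‖a z‖ ≤ 1) (x : X) :
    mulOp a ha (delta x) = a x • delta x := by
  refine lp.ext (funext fun z => ?_)
  rw [mulOp_apply, lp.coeFn_smul, Pi.smul_apply, smul_eq_mul]
  by_cases h : z = x
  · rw [h]
  · rw [delta_apply_ne h, mul_zero, mul_zero]

/-- The rank one projection onto the span of `δ_x`. -/
def proj (x : X) : EllTwo X →L[ℂ] EllTwo X := InnerProductSpace.rankOne ℂ (delta x) (delta x)

theorem proj_apply (x : X) (f : EllTwo X) : proj x f = f x • delta x := by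
  rw [proj, InnerProductSpace.rankOne_apply, inner_delta]

theorem mulOp_mul_proj (a : X → ℂ) (ha : ∀ z, ‖a z‖ ≤ 1) (x : X) :
    mulOp a ha * proj x = a x • proj x := by
  ext1 f
  rw [mul_apply_eq_comp, proj_apply, map_smul, mulOp_delta, smul_apply, proj_apply,
    smul_comm]

theorem proj_mul_mul_proj (T : EllTwo X →L[ℂ] EllTwo X) (x x' : X) :
    proj x' * T * proj x = coeff T x x' • (InnerProductSpace.rankOne ℂ (delta x') (delta x)) := by
  ext1 f
  simp only [mul_apply_eq_comp, proj_apply, map_smul, smul_apply, coeff_eq,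
    InnerProductSpace.rankOne_apply, inner_delta, smul_smul]
  rw [mul_comm]

theorem star_proj (x : X) : star (proj x) = proj x := by
  rw [proj, ContinuousLinearMap.star_eq_adjoint, InnerProductSpace.adjoint_rankOne]

theorem proj_mul_proj_self (x : X) : proj x * proj x = proj x := by
  ext1 f
  simp [proj_apply, delta_apply_self]

theorem proj_mul_proj_ne {x x' : X} (h : x ≠ x') : proj x * proj x' = 0 := by
  ext1 f
  simp [proj_apply, delta_apply_ne h]

theorem proj_ne_zero (x : X) : proj x ≠ 0 := by
  intro h
  have := congrArg (fun T => T (delta x) x) h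
  simp [proj_apply, delta_apply_self] at this

end Operators

/-! ### Membership in the uniform Roe algebra and decay of coefficients off entourages. -/

namespace CoarseStructure

variable {X : Type u} (𝓔 : CoarseStructure X)

theorem mem_uniformRoeAlgebra_of_coeff {T : EllTwo X →L[ℂ] EllTwo X} {E : Set (X × X)}
    (hE : E ∈ 𝓔.entourages) (hT : ∀ x x', (x, x') ∉ E → coeff T x x' = 0) :
    T ∈ 𝓔.uniformRoeAlgebra :=
  StarSubalgebra.le_topologicalClosure _ ⟨E, hE, hT⟩

theorem mulOp_mem (a : X → ℂ) (ha : ∀ z, ‖a z‖ ≤ 1) : mulOp a ha ∈ 𝓔.uniformRoeAlgebra := by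
  refine 𝓔.mem_uniformRoeAlgebra_of_coeff 𝓔.diag_mem fun x x' h => ?_
  rw [coeff_eq, mulOp_apply, delta_apply_ne fun h' => h h'.symm, mul_zero]

theorem proj_mem (x : X) : proj x ∈ 𝓔.uniformRoeAlgebra := by
  refine 𝓔.mem_uniformRoeAlgebra_of_coeff 𝓔.diag_mem fun x₁ x₂ h => ?_
  rw [coeff_eq, proj_apply, lp.coeFn_smul, Pi.smul_apply, smul_eq_mul]
  by_cases h' : x = x₁
  · rw [h', delta_apply_ne (x := x₁) (z := x₂) fun h' => h h'.symm, mul_zero]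
  · rw [delta_apply_ne h', zero_mul]

/-- Elements of the uniform Roe algebra have small matrix coefficients off some entourage. -/
theorem exists_entourage_coeff_lt {T : EllTwo X →L[ℂ] EllTwo X} (hT : T ∈ 𝓔.uniformRoeAlgebra)
    {ε : ℝ} (hε : 0 < ε) :
    ∃ E ∈ 𝓔.entourages, ∀ x x', (x, x') ∉ E → ‖coeff T x x'‖ < ε := by
  have hT' : T ∈ closure (𝓔.algUniformRoeAlgebra : Set (EllTwo X →L[ℂ] EllTwo X)) := hT
  obtain ⟨S, ⟨E, hE, hS⟩, hST⟩ := Metric.mem_closure_iff.1 hT' ε hε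
  refine ⟨E, hE, fun x x' h => ?_⟩
  have h₁ : coeff T x x' = coeff (T - S) x x' := by
    have h₂ := hS x x' h
    rw [coeff_eq] at h₂
    simp only [coeff_eq, sub_apply, lp.coeFn_sub, Pi.sub_apply, h₂, sub_zero]
  rw [h₁]
  exact (norm_coeff_le _ _ _).trans_lt (by rwa [dist_eq_norm] at hST)

theorem singleton_mem_of_coeff_ne_zero {T : EllTwo X →L[ℂ] EllTwo X}
    (hT : T ∈ 𝓔.uniformRoeAlgebra) {x x' : X} (h : coeff T x x' ≠ 0) : {(x, x')} ∈ 𝓔.entourages := by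
  obtain ⟨E, hE, hE'⟩ := 𝓔.exists_entourage_coeff_lt hT (norm_pos_iff.2 h)
  refine 𝓔.subset_mem E hE _ (Set.singleton_subset_iff.2 ?_)
  by_contra hx
  exact lt_irrefl _ (hE' x x' hx)

end CoarseStructure

/-! ### Isomorphisms of uniform Roe algebras on rank one projections -/

namespace CoarseStructure

variable {X : Type u} {Y : Type v}

/-- The projection onto the span of `δ_x`, as an element of the uniform Roe algebra. -/
def projR (𝓔 : CoarseStructure X) (x : X) : 𝓔.uniformRoeAlgebra := ⟨proj x, 𝓔.proj_mem x⟩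

/-- Multiplication by a function bounded by one, as an element of the uniform Roe algebra. -/
def mulR (𝓔 : CoarseStructure X) (a : X → ℂ) (ha : ∀ x, ‖a x‖ ≤ 1) : 𝓔.uniformRoeAlgebra :=
  ⟨mulOp a ha, 𝓔.mulOp_mem a ha⟩

variable {𝓔 : CoarseStructure X} {𝓕 : CoarseStructure Y}

theorem coeR_mul (S T : 𝓔.uniformRoeAlgebra) : ((S * T : 𝓔.uniformRoeAlgebra) :
    EllTwo X →L[ℂ] EllTwo X) = (S : EllTwo X →L[ℂ] EllTwo X) * (T : EllTwo X →L[ℂ] EllTwo X) := rfl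

theorem coeR_smul (c : ℂ) (T : 𝓔.uniformRoeAlgebra) : ((c • T : 𝓔.uniformRoeAlgebra) :
    EllTwo X →L[ℂ] EllTwo X) = c • (T : EllTwo X →L[ℂ] EllTwo X) := rfl

theorem coeR_star (T : 𝓔.uniformRoeAlgebra) : ((star T : 𝓔.uniformRoeAlgebra) :
    EllTwo X →L[ℂ] EllTwo X) = star (T : EllTwo X →L[ℂ] EllTwo X) := rfl

theorem projR_mul_mul_projR (T : 𝓔.uniformRoeAlgebra) (x : X) :
    𝓔.projR x * T * 𝓔.projR x = coeff (T : EllTwo X →L[ℂ] EllTwo X) x x • 𝓔.projR x :=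
  Subtype.ext (proj_mul_mul_proj _ _ _)

theorem star_projR (x : X) : star (𝓔.projR x) = 𝓔.projR x := Subtype.ext (star_proj x)

theorem projR_mul_self (x : X) : 𝓔.projR x * 𝓔.projR x = 𝓔.projR x :=
  Subtype.ext (proj_mul_proj_self x)

theorem projR_ne_zero (x : X) : 𝓔.projR x ≠ 0 := fun h => proj_ne_zero x (congrArg Subtype.val h)

theorem mulR_mul_projR (a : X → ℂ) (ha : ∀ x, ‖a x‖ ≤ 1) (x : X) :
    𝓔.mulR a ha * 𝓔.projR x = a x • 𝓔.projR x := Subtype.ext (mulOp_mul_proj a ha x)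

variable (Φ : 𝓔.uniformRoeAlgebra ≃⋆ₐ[ℂ] 𝓕.uniformRoeAlgebra)

theorem map_starR (T : 𝓔.uniformRoeAlgebra) : Φ (star T) = star (Φ T) := Φ.map_star' T

/-- Compressing any operator by the projection onto `δ_x` gives a scalar multiple of it, and `Φ`
preserves this. Applied to the preimage of the projection onto some `δ_y` with P δ_y ≠ 0, it shows
that the rank one operator P (proj y) P is a multiple of P. -/
theorem exists_map_projR (x : X) : ∃ ξ : EllTwo Y, ‖ξ‖ = 1 ∧
    (Φ (𝓔.projR x) : EllTwo Y →L[ℂ] EllTwo Y) = InnerProductSpace.rankOne ℂ ξ ξ := by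
  set P : EllTwo Y →L[ℂ] EllTwo Y := (Φ (𝓔.projR x) : EllTwo Y →L[ℂ] EllTwo Y) with hP
  have hstar : star P = P := by
    rw [hP, ← coeR_star, ← map_starR, star_projR]
  have hidem : P * P = P := by
    rw [hP, ← coeR_mul, ← map_mul, projR_mul_self]
  have hne : P ≠ 0 := fun h => projR_ne_zero (𝓔 := 𝓔) x <| by
    have h' : Φ (𝓔.projR x) = 0 := Subtype.ext h
    simpa using h'
  obtain ⟨y, hy⟩ : ∃ y, P (delta y) ≠ 0 := by
    by_contra! h
    exact hne (eq_zero_of_forall_delta h)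
  obtain ⟨c, hc⟩ : ∃ c : ℂ, P * proj y * P = c • P := by
    have h := congrArg (fun T => (Φ T : EllTwo Y →L[ℂ] EllTwo Y))
      (projR_mul_mul_projR (Φ.symm (𝓕.projR y)) x)
    simp only [map_mul, map_smul, StarAlgEquiv.apply_symm_apply, coeR_mul, coeR_smul] at h
    exact ⟨_, h⟩
  set η := P (delta y) with hη
  have hsymm : ∀ f g, inner ℂ (P f) g = inner ℂ f (P g) := fun f g => by
    conv_lhs => rw [← hstar]
    rw [ContinuousLinearMap.star_eq_adjoint, ContinuousLinearMap.adjoint_inner_left]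
  have hv : ∀ f, inner ℂ η f • η = c • P f := fun f => by
    have h := congrArg (fun T => T f) hc
    simp only [mul_apply_eq_comp, proj_apply, map_smul, smul_apply] at h
    rw [← h, hη, hsymm, inner_delta]
  have hPη : P η = η := by
    rw [hη, ← mul_apply_eq_comp, hidem]
  have hcη : c = (‖η‖ : ℂ) ^ 2 := by
    have h := hv η
    rw [hPη, inner_self_eq_norm_sq_to_K] at h
    exact (smul_left_injective ℂ hy h).symm
  have hn : (‖η‖ : ℂ) ≠ 0 := by simpa using hy
  refine ⟨(‖η‖ : ℂ)⁻¹ • η, ?_, ?_⟩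
  · rw [norm_smul, norm_inv, Complex.norm_real, norm_norm, inv_mul_cancel₀ (norm_ne_zero_iff.2 hy)]
  · ext1 f
    have h := hv f
    rw [hcη] at h
    rw [InnerProductSpace.rankOne_apply, inner_smul_left, smul_smul, mul_right_comm,
      mul_smul, h, smul_smul]
    simp only [map_inv₀, Complex.conj_ofReal]
    rw [show (‖η‖ : ℂ)⁻¹ * (‖η‖ : ℂ)⁻¹ * (‖η‖ : ℂ) ^ 2 = 1 by field_simp, one_smul]

/-- A unit vector spanning the range of the image of the projection onto the span of `δ_x`. -/
def vec (x : X) : EllTwo Y := (exists_map_projR Φ x).choose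

theorem norm_vec (x : X) : ‖vec Φ x‖ = 1 := (exists_map_projR Φ x).choose_spec.1

theorem coe_map_projR (x : X) : (Φ (𝓔.projR x) : EllTwo Y →L[ℂ] EllTwo Y) =
    InnerProductSpace.rankOne ℂ (vec Φ x) (vec Φ x) := (exists_map_projR Φ x).choose_spec.2

theorem inner_vec_self (x : X) : inner ℂ (vec Φ x) (vec Φ x) = 1 := by
  rw [inner_self_eq_norm_sq_to_K, norm_vec]
  simp

theorem map_projR_vec (x : X) : (Φ (𝓔.projR x) : EllTwo Y →L[ℂ] EllTwo Y) (vec Φ x) = vec Φ x := by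
  rw [coe_map_projR, InnerProductSpace.rankOne_apply, inner_vec_self, one_smul]

theorem vec_ne_zero (x : X) : vec Φ x ≠ 0 := norm_ne_zero_iff.1 (by rw [norm_vec]; exact one_ne_zero)

theorem orthonormal_vec : Orthonormal ℂ (vec Φ) := by
  refine ⟨norm_vec Φ, fun x x' h => ?_⟩
  have h₁ : Φ (𝓔.projR x) * Φ (𝓔.projR x') = 0 := by
    rw [← map_mul, show 𝓔.projR x * 𝓔.projR x' = 0 from Subtype.ext (proj_mul_proj_ne h), map_zero]
  have h₂ := congrArg (fun T : 𝓕.uniformRoeAlgebra => (T : EllTwo Y →L[ℂ] EllTwo Y) (vec Φ x')) h₁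
  simp only [coeR_mul, mul_apply_eq_comp, map_projR_vec] at h₂
  rw [coe_map_projR, InnerProductSpace.rankOne_apply] at h₂
  exact (smul_eq_zero.1 h₂).resolve_right (vec_ne_zero Φ x)

theorem coeff_map_projR (x : X) (y : Y) :
    coeff (Φ (𝓔.projR x) : EllTwo Y →L[ℂ] EllTwo Y) y y = (‖vec Φ x y‖ : ℂ) ^ 2 := by
  rw [coeff_eq, coe_map_projR, InnerProductSpace.rankOne_apply, lp.coeFn_smul, Pi.smul_apply,
    smul_eq_mul, ← inner_conj_symm, inner_delta, RCLike.conj_mul]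
  rfl

/-- Both squares are the scalar by which compressing the preimage of `proj y` to `δ_x` scales the
projection, computed once before and once after applying `Φ`. -/
theorem norm_vec_symm (x : X) (y : Y) : ‖vec Φ.symm y x‖ = ‖vec Φ x y‖ := by
  have h₁ := congrArg Φ (projR_mul_mul_projR (Φ.symm (𝓕.projR y)) x)
  rw [coeff_map_projR, map_smul, map_mul, map_mul, StarAlgEquiv.apply_symm_apply] at h₁
  have h₂ := congrArg (fun T : 𝓕.uniformRoeAlgebra =>
    inner ℂ (vec Φ x) ((T : EllTwo Y →L[ℂ] EllTwo Y) (vec Φ x))) h₁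
  have h₃ : ((𝓕.projR y : 𝓕.uniformRoeAlgebra) : EllTwo Y →L[ℂ] EllTwo Y) = proj y := rfl
  simp only [coeR_mul, mul_apply_eq_comp, map_projR_vec, coeR_smul,
    smul_apply, inner_smul_right, inner_vec_self, h₃, proj_apply, map_smul] at h₂
  rw [coe_map_projR, InnerProductSpace.rankOne_apply, inner_smul_right, inner_vec_self,
    ← inner_conj_symm, inner_delta, mul_one, RCLike.mul_conj, mul_one] at h₂
  have h₄ : ‖vec Φ x y‖ ^ 2 = ‖vec Φ.symm y x‖ ^ 2 := by
    refine Complex.ofReal_injective ?_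
    push_cast
    exact h₂
  exact ((pow_left_inj₀ (norm_nonneg _) (norm_nonneg _) two_ne_zero).1 h₄).symm

theorem hasSum_norm_vec_sq (y : Y) : HasSum (fun x => ‖vec Φ x y‖ ^ 2) 1 := by
  have h := hasSum_norm_sq (vec Φ.symm y)
  simp only [norm_vec_symm, norm_vec] at h
  simpa using h

/-- The images of the rank one projections onto the standard basis span the whole space. -/
theorem orthogonal_span_vec : (Submodule.span ℂ (Set.range (vec Φ)))ᗮ = ⊥ := by
  rw [Submodule.eq_bot_iff]
  intro v hv
  have hv' : ∀ x, inner ℂ (vec Φ x) v = 0 := fun x =>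
    (Submodule.mem_orthogonal _ _).1 hv _ (Submodule.subset_span ⟨x, rfl⟩)
  refine lp.ext (funext fun y => ?_)
  have hbound : ∀ s : Finset X,
      ‖v y‖ ^ 2 ≤ ‖v‖ ^ 2 * (1 - ∑ x ∈ s, ‖vec Φ x y‖ ^ 2) := fun s => by
    -- `w` is the part of `δ_y` left after projecting to finitely many `vec Φ x`. Pairing it with
    -- `v` still gives `v y`, while its norm tends to 0 because the squares |ξ_x(y)|² sum to 1 over
    -- x.
    set w : EllTwo Y := delta y - ∑ x ∈ s, inner ℂ (vec Φ x) (delta y) • vec Φ x with hw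
    have h₁ : inner ℂ w v = v y := by
      rw [hw, inner_sub_left, inner_delta, sum_inner]
      simp [inner_smul_left, hv']
    have h₂ : ‖w‖ ^ 2 = 1 - ∑ x ∈ s, ‖vec Φ x y‖ ^ 2 := by
      have hin : ∀ x, inner ℂ (delta y) (vec Φ x) = vec Φ x y := fun x => inner_delta _ _
      have hin' : ∀ x, inner ℂ (vec Φ x) (delta y) = (starRingEnd ℂ) (vec Φ x y) := fun x => by
        rw [← inner_conj_symm, inner_delta]
      have h : (‖w‖ ^ 2 : ℂ) = 1 - ∑ x ∈ s, (‖vec Φ x y‖ : ℂ) ^ 2 := by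
        have h₀ : inner ℂ w w = (‖w‖ : ℂ) ^ 2 := inner_self_eq_norm_sq_to_K w
        have h₃ : inner ℂ (∑ x ∈ s, inner ℂ (vec Φ x) (delta y) • vec Φ x)
            (∑ x ∈ s, inner ℂ (vec Φ x) (delta y) • vec Φ x) =
            ∑ x ∈ s, (‖vec Φ x y‖ : ℂ) ^ 2 := by
          rw [(orthonormal_vec Φ).inner_sum]
          refine Finset.sum_congr rfl fun x _ => ?_
          rw [hin', RCLike.conj_conj, RCLike.mul_conj]
          rfl
        rw [← h₀, hw, inner_sub_left, inner_sub_right, inner_sub_right, h₃, inner_sum, sum_inner,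
          inner_self_eq_norm_sq_to_K, norm_delta]
        simp only [inner_smul_left, inner_smul_right, hin, hin', RCLike.conj_conj]
        simp only [RCLike.conj_mul, RCLike.mul_conj]
        simp
      exact_mod_cast h
    rw [← h₁, ← h₂, ← mul_pow]
    refine pow_le_pow_left₀ (norm_nonneg _) ?_ 2
    rw [mul_comm]
    exact norm_inner_le_norm _ _
  have hlim : Filter.Tendsto (fun s : Finset X => ‖v‖ ^ 2 * (1 - ∑ x ∈ s, ‖vec Φ x y‖ ^ 2))
      Filter.atTop (nhds (‖v‖ ^ 2 * (1 - 1))) :=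
    ((hasSum_norm_vec_sq Φ y).const_sub 1).const_mul _
  have h0 := ge_of_tendsto' hlim hbound
  rw [sub_self, mul_zero] at h0
  have h1 : ‖v y‖ = 0 := by
    have := sq_nonneg ‖v y‖
    exact pow_eq_zero_iff two_ne_zero |>.1 (le_antisymm h0 this)
  simpa using h1

/-- The vectors `vec Φ x` as a Hilbert basis. -/
def vecBasis : HilbertBasis X ℂ (EllTwo Y) :=
  HilbertBasis.mkOfOrthogonalEqBot (orthonormal_vec Φ) (orthogonal_span_vec Φ)

theorem vecBasis_apply (x : X) : vecBasis Φ x = vec Φ x := by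
  rw [vecBasis, HilbertBasis.coe_mkOfOrthogonalEqBot]

theorem map_mulR_vec (a : X → ℂ) (ha : ∀ x, ‖a x‖ ≤ 1) (x : X) :
    (Φ (𝓔.mulR a ha) : EllTwo Y →L[ℂ] EllTwo Y) (vec Φ x) = a x • vec Φ x := by
  have h := congrArg (fun T => (Φ T : EllTwo Y →L[ℂ] EllTwo Y) (vec Φ x))
    (mulR_mul_projR (𝓔 := 𝓔) a ha x)
  simpa only [map_mul, map_smul, coeR_mul, mul_apply_eq_comp, map_projR_vec,
    coeR_smul, smul_apply] using h

/-- No weak continuity of `Φ` is needed: the image is a bounded operator that is diagonal on a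
Hilbert basis. -/
theorem hasSum_inner_map_mulR (a : X → ℂ) (ha : ∀ x, ‖a x‖ ≤ 1) (v w : EllTwo Y) :
    HasSum (fun x => a x * (inner ℂ w (vec Φ x) * inner ℂ (vec Φ x) v))
      (inner ℂ w ((Φ (𝓔.mulR a ha) : EllTwo Y →L[ℂ] EllTwo Y) v)) := by
  have h := (((vecBasis Φ).hasSum_repr v).mapL
    (Φ (𝓔.mulR a ha) : EllTwo Y →L[ℂ] EllTwo Y)).mapL (innerSL ℂ w)
  simp only [HilbertBasis.repr_apply_apply, vecBasis_apply, map_smul, map_mulR_vec,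
    innerSL_apply_apply, smul_eq_mul] at h
  convert! h using 2
  ring

theorem summable_norm_inner_mul_inner (v w : EllTwo Y) :
    Summable fun x => ‖inner ℂ w (vec Φ x) * inner ℂ (vec Φ x) v‖ := by
  have h := ((vecBasis Φ).summable_inner_mul_inner w v).norm
  simpa only [vecBasis_apply] using h

/-- The relations p_{x'} V p_x = V p_x and p_x V* V p_x = p_x are algebraic, so `Φ` preserves them.
The first fixes the line containing the image vector, the second its norm. -/
theorem exists_map_vec_eq (V : 𝓔.uniformRoeAlgebra) {x x' : X}
    (hV : (V : EllTwo X →L[ℂ] EllTwo X) (delta x) = delta x') :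
    ∃ c : ℂ, ‖c‖ = 1 ∧ (Φ V : EllTwo Y →L[ℂ] EllTwo Y) (vec Φ x) = c • vec Φ x' := by
  have h₁ : 𝓔.projR x' * V * 𝓔.projR x = V * 𝓔.projR x := by
    refine Subtype.ext (ContinuousLinearMap.ext fun f => ?_)
    simp [projR, proj_apply, hV, delta_apply_self]
  have h₂ : (𝓔.projR x * (star V * V)) * 𝓔.projR x = 𝓔.projR x := by
    rw [projR_mul_mul_projR]
    have : coeff ((star V * V : 𝓔.uniformRoeAlgebra) : EllTwo X →L[ℂ] EllTwo X) x x = 1 := by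
      rw [coeff, coeR_mul, coeR_star, mul_apply_eq_comp,
        ContinuousLinearMap.star_eq_adjoint, ContinuousLinearMap.adjoint_inner_right, hV,
        inner_self_eq_norm_sq_to_K, norm_delta]
      simp
    rw [this, one_smul]
  set u := (Φ V : EllTwo Y →L[ℂ] EllTwo Y) (vec Φ x) with hu
  have h₃ : u = inner ℂ (vec Φ x') u • vec Φ x' := by
    have h := congrArg (fun T => (Φ T : EllTwo Y →L[ℂ] EllTwo Y) (vec Φ x)) h₁
    simp only [map_mul, coeR_mul, mul_apply_eq_comp, map_projR_vec] at h
    rw [coe_map_projR, InnerProductSpace.rankOne_apply] at h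
    exact h.symm
  have h₄ : ‖u‖ = 1 := by
    have h := congrArg (fun T => inner ℂ (vec Φ x) ((Φ T : EllTwo Y →L[ℂ] EllTwo Y) (vec Φ x))) h₂
    simp only [map_mul, map_starR, coeR_mul, coeR_star,
      mul_apply_eq_comp, map_projR_vec] at h
    rw [coe_map_projR, InnerProductSpace.rankOne_apply, inner_smul_right, inner_vec_self, mul_one,
      ContinuousLinearMap.star_eq_adjoint, ContinuousLinearMap.adjoint_inner_right, ← hu,
      inner_self_eq_norm_sq_to_K] at h
    have h' : ‖u‖ ^ 2 = 1 := by
      refine Complex.ofReal_injective ?_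
      push_cast
      exact h
    exact (pow_eq_one_iff_of_nonneg (norm_nonneg _) two_ne_zero).1 h'
  refine ⟨_, ?_, h₃⟩
  have h₅ := congrArg norm h₃
  rwa [norm_smul, norm_vec, mul_one, h₄, eq_comm] at h₅

end CoarseStructure

namespace CoarseStructure

variable {X : Type u} {Y : Type v} {𝓔 : CoarseStructure X} {𝓕 : CoarseStructure Y}

/-! ### Ghost projections -/

theorem finite_of_isCompactOperator {H ι : Type*} [NormedAddCommGroup H] [InnerProductSpace ℂ H]
    [CompleteSpace H] {ξ : ι → H} (hξ : Orthonormal ℂ ξ) {P : H →L[ℂ] H} (hP : IsCompactOperator P)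
    (h : ∀ i, P (ξ i) = ξ i) : Finite ι := by
  have hfin := ContinuousLinearMap.finite_dimensional_eigenspace hP 1 one_ne_zero
  have hmem : ∀ i, ξ i ∈ Module.End.eigenspace P.toLinearMap 1 := fun i => by
    rw [Module.End.mem_eigenspace_iff, one_smul]
    exact h i
  have hli : LinearIndependent ℂ fun i =>
      (⟨ξ i, hmem i⟩ : Module.End.eigenspace P.toLinearMap (1 : ℂ)) :=
    LinearIndependent.of_comp (Submodule.subtype _) hξ.linearIndependent
  exact hli.finite

/-- Otherwise there are infinitely many ξ_x with rapidly decreasing sup norms. The coordinate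
projection onto these x is mapped to a projection P whose columns tend to 0 in norm, hence to a
ghost. P is compact yet fixes an infinite orthonormal family, which is impossible. -/
theorem exists_lower_bound_of_ghostProjectionsCompact
    (Φ : 𝓔.uniformRoeAlgebra ≃⋆ₐ[ℂ] 𝓕.uniformRoeAlgebra) (h𝓕 : 𝓕.GhostProjectionsCompact) :
    ∃ δ : ℝ, 0 < δ ∧ ∀ x, ∃ y, δ ≤ ‖vec Φ x y‖ := by
  classical
  by_contra! hcon
  -- The geometric rate makes the squared coordinates summable, which supplies the dominating series
  -- below.
  choose x hx using fun n : ℕ => hcon ((1 / 2) ^ n) (by positivity)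
  set A : Set X := Set.range x with hA
  -- The points `x n` may repeat; but finitely many nonzero vectors would have nonzero coordinates
  -- bounded below, against the bound (1/2)^n.
  have hinf : A.Infinite := by
    intro hfin
    choose c hc using fun z => exists_apply_ne_zero (vec_ne_zero Φ z)
    obtain ⟨z, -, hz⟩ := Set.exists_min_image A (fun z => ‖vec Φ z (c z)‖) hfin ⟨x 0, 0, rfl⟩
    obtain ⟨n, hn⟩ := exists_pow_lt_of_lt_one (norm_pos_iff.2 (hc z)) (one_half_lt_one (α := ℝ))
    exact absurd ((hz _ ⟨n, rfl⟩).trans_lt (hx n _)) (not_lt.2 hn.le)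
  have ha : ∀ z, ‖A.indicator (1 : X → ℂ) z‖ ≤ 1 := fun z => by
    by_cases h : z ∈ A <;> simp [h]
  set p : 𝓔.uniformRoeAlgebra := 𝓔.mulR (A.indicator 1) ha with hp
  set P : EllTwo Y →L[ℂ] EllTwo Y := (Φ p : EllTwo Y →L[ℂ] EllTwo Y) with hP
  have hpp : p * p = p := by
    refine Subtype.ext (ContinuousLinearMap.ext fun f => lp.ext (funext fun z => ?_))
    simp only [hp, mulR, coeR_mul, mul_apply_eq_comp, mulOp_apply]
    by_cases h : z ∈ A <;> simp [h]
  have hps : star p = p := by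
    refine Subtype.ext (ContinuousLinearMap.ext fun f => lp.ext (funext fun z => ?_))
    rw [coeR_star, ← inner_delta, ContinuousLinearMap.star_eq_adjoint,
      ContinuousLinearMap.adjoint_inner_right]
    simp only [hp, mulR, mulOp_delta, mulOp_apply, inner_smul_left, inner_delta]
    by_cases h : z ∈ A <;> simp [h]
  have hPP : P * P = P := by rw [hP, ← coeR_mul, ← map_mul, hpp]
  have hPs : star P = P := by rw [hP, ← coeR_star, ← map_starR, hps]
  have hsum : ∀ y, HasSum (fun z : A => ‖vec Φ z y‖ ^ 2) (‖P (delta y)‖ ^ 2) := fun y => by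
    have h := hasSum_inner_map_mulR Φ (A.indicator 1) ha (delta y) (delta y)
    have h₁ : inner ℂ (delta y) (P (delta y)) = ((‖P (delta y)‖ ^ 2 : ℝ) : ℂ) := by
      push_cast
      conv_lhs => rw [← hPP]
      rw [mul_apply_eq_comp, ← ContinuousLinearMap.adjoint_inner_left,
        ← ContinuousLinearMap.star_eq_adjoint, hPs]
      exact inner_self_eq_norm_sq_to_K _
    change HasSum _ (inner ℂ (delta y) (P (delta y))) at h
    rw [h₁] at h
    have h₂ : ∀ z, A.indicator (1 : X → ℂ) z *
        (inner ℂ (delta y) (vec Φ z) * inner ℂ (vec Φ z) (delta y)) =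
        ((A.indicator (fun z => ‖vec Φ z y‖ ^ 2) z : ℝ) : ℂ) := fun z => by
      rw [← inner_conj_symm (vec Φ z), inner_delta, RCLike.mul_conj]
      by_cases h : z ∈ A <;> simp [h]
    simp only [h₂, Complex.hasSum_ofReal] at h
    exact (hasSum_subtype_iff_indicator (f := fun z => ‖vec Φ z y‖ ^ 2)).2 h
  have hlim : Filter.Tendsto (fun y => ‖P (delta y)‖ ^ 2) Filter.cofinite (nhds 0) := by
    choose n hn using fun z : A => z.2
    have hninj : Function.Injective n := fun z z' h => Subtype.ext (by rw [← hn z, ← hn z', h])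
    have hb : Summable fun z : A => ((1 / 4 : ℝ)) ^ n z :=
      (summable_geometric_of_lt_one (by norm_num) (by norm_num)).comp_injective hninj
    have h := tendsto_tsum_of_dominated_convergence (𝓕 := Filter.cofinite)
      (f := fun (y : Y) (z : A) => ‖vec Φ z y‖ ^ 2) (g := fun _ => 0) hb
      (fun z => tendsto_norm_apply_cofinite _) (Filter.Eventually.of_forall fun y z => by
        have h := hx (n z) y
        rw [hn z] at h
        rw [Real.norm_of_nonneg (by positivity)]
        refine (pow_le_pow_left₀ (norm_nonneg _) h.le 2).trans_eq ?_
        rw [← pow_mul, mul_comm, pow_mul]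
        norm_num)
    simp only [(hsum _).tsum_eq, tsum_zero] at h
    exact h
  have hghost : IsGhost P := fun ε hε => by
    have h := hlim.eventually (gt_mem_nhds (show (0 : ℝ) < ε ^ 2 by positivity))
    -- An entry is at most the norm of its column, so only `y` has to avoid the finite set.
    refine ⟨_, h, fun y y' hy _ => ?_⟩
    simp only [Set.mem_compl_iff, not_not] at hy
    have hy' : ‖P (delta y)‖ ^ 2 < ε ^ 2 := hy
    refine lt_of_le_of_lt ?_ (lt_of_pow_lt_pow_left₀ 2 hε.le hy')
    refine (norm_inner_le_norm _ _).trans_eq ?_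
    rw [norm_delta, one_mul]
  have hcomp := h𝓕 P (Φ p).2 ⟨hPP, hPs⟩ hghost
  have hfin : Finite A := finite_of_isCompactOperator
    ((orthonormal_vec Φ).comp ((↑) : A → X) Subtype.val_injective) hcomp fun z => by
      simp only [Function.comp_apply, hP, hp, map_mulR_vec, Set.indicator_of_mem z.2,
        Pi.one_apply, one_smul]
  exact hinf hfin

end CoarseStructure

namespace CoarseStructure

variable {X : Type u} {Y : Type v} {𝓔 : CoarseStructure X} {𝓕 : CoarseStructure Y}

/-! ### Genericity -/

theorem finite_mem {K : Set (X × X)} (hK : K.Finite) (h : ∀ p ∈ K, {p} ∈ 𝓔.entourages) :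
    K ∈ 𝓔.entourages := by
  induction K, hK using Set.Finite.induction_on with
  | empty => exact 𝓔.subset_mem _ 𝓔.diag_mem _ (Set.empty_subset _)
  | @insert p K _ _ ih =>
    rw [Set.insert_eq]
    exact 𝓔.union_mem _ (h p (Set.mem_insert _ _)) _ (ih fun q hq => h q (Set.mem_insert_of_mem _ hq))

/-- The operator sending `δ_{x i}` to `δ_{x' i}` and vanishing on the remaining basis vectors. -/
theorem exists_partialTranslation {ι : Type*} {x x' : ι → X} (hx : x.Injective)
    (hx' : x'.Injective) {E : Set (X × X)} (hE : E ∈ 𝓔.entourages) (h : ∀ i, (x i, x' i) ∈ E) :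
    ∃ V : 𝓔.uniformRoeAlgebra, ∀ i, (V : EllTwo X →L[ℂ] EllTwo X) (delta (x i)) = delta (x' i) := by
  classical
  have ha : ∀ i, Function.extend x' (fun _ => (1 : ℂ)) 0 (x' i) = 1 := fun i =>
    hx'.extend_apply _ _ _
  have hs : ∀ i, Function.extend x' x id (x' i) = x i := fun i => hx'.extend_apply _ _ _
  have ha' : ∀ z, Function.extend x' (fun _ => (1 : ℂ)) 0 z ≠ 0 → ∃ i, x' i = z := fun z hz => by
    by_contra hc
    exact hz (Function.extend_apply' _ _ _ hc)
  obtain ⟨V, hV⟩ := exists_weighted_composition (Function.extend x' (fun _ => (1 : ℂ)) 0)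
    (Function.extend x' x id) (fun z => by
      by_cases hz : ∃ i, x' i = z
      · obtain ⟨i, rfl⟩ := hz
        simp [ha]
      · simp [Function.extend_apply' _ _ _ hz]) (fun z z' hz hz' hzz' => by
      obtain ⟨i, rfl⟩ := ha' z hz
      obtain ⟨j, rfl⟩ := ha' z' hz'
      rw [hs, hs] at hzz'
      rw [hx hzz'])
  refine ⟨⟨V, 𝓔.mem_uniformRoeAlgebra_of_coeff hE fun u z huz => ?_⟩, fun i => ?_⟩
  · rw [coeff_eq, hV]
    by_contra hne
    obtain ⟨i, rfl⟩ := ha' z (left_ne_zero_of_mul hne)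
    rw [hs] at hne
    have hu : x i = u := by
      by_contra hc
      exact hne (by rw [delta_apply_ne hc, mul_zero])
    exact huz (hu ▸ h i)
  · refine lp.ext (funext fun z => ?_)
    change V (delta (x i)) z = _
    rw [hV]
    by_cases hz : ∃ j, x' j = z
    · obtain ⟨j, rfl⟩ := hz
      rw [ha, hs, one_mul]
      by_cases hij : j = i
      · rw [hij, delta_apply_self, delta_apply_self]
      · rw [delta_apply_ne (hx.ne hij), delta_apply_ne (hx'.ne hij)]
    · have h0 : Function.extend x' (fun _ => (1 : ℂ)) 0 z = 0 := Function.extend_apply' _ _ _ hz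
      rw [h0, zero_mul, delta_apply_ne]
      rintro rfl
      exact hz ⟨i, rfl⟩

/-- The function on `X` taking the value `a (y i)` at `x i`, and zero off the range of `x`. -/
def transplant {ι : Type*} (x : ι → X) (y : ι → Y) (a : Y → Disk) : X → ℂ :=
  Function.extend x (fun i => (a (y i) : ℂ)) 0

/-! ### Open dense sets of multipliers in `Y → Disk`. -/

section Transplant

variable {ι : Type*} {x : ι → X} {y : ι → Y}

theorem transplant_apply (hx : x.Injective) (a : Y → Disk) (i : ι) :
    transplant x y a (x i) = a (y i) := hx.extend_apply _ _ _

theorem transplant_apply' (a : Y → Disk) {u : X} (hu : ¬ ∃ i, x i = u) :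
    transplant x y a u = 0 := Function.extend_apply' _ _ _ hu

theorem norm_transplant_le (hx : x.Injective) (a : Y → Disk) (u : X) :
    ‖transplant x y a u‖ ≤ 1 := by
  by_cases hu : ∃ i, x i = u
  · obtain ⟨i, rfl⟩ := hu
    rw [transplant_apply hx]
    exact (a (y i)).2
  · rw [transplant_apply' a hu]
    simp

theorem continuous_tsum_transplant (hx : x.Injective) {b : X → ℂ} (hb : Summable fun u => ‖b u‖) :
    Continuous fun a : Y → Disk => ∑' u, transplant x y a u * b u := by
  refine continuous_tsum (fun u => ?_) hb fun u a => ?_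
  · by_cases hu : ∃ i, x i = u
    · obtain ⟨i, rfl⟩ := hu
      simp only [transplant_apply hx]
      fun_prop
    · simp only [transplant_apply' _ hu]
      fun_prop
  · rw [norm_mul]
    exact mul_le_of_le_one_left (norm_nonneg _) (norm_transplant_le hx a u)

theorem tsum_transplant_update [DecidableEq Y] (hx : x.Injective) (hy : y.Injective) {b : X → ℂ}
    (hb : Summable fun u => ‖b u‖) (a : Y → Disk) (i : ι) (t t' : Disk) :
    ∑' u, transplant x y (Function.update a (y i) t) u * b u -
      ∑' u, transplant x y (Function.update a (y i) t') u * b u = ((t : ℂ) - t') * b (x i) := by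
  have hs : ∀ a : Y → Disk, Summable fun u => transplant x y a u * b u := fun a =>
    Summable.of_norm_bounded hb fun u => by
      rw [norm_mul]
      exact mul_le_of_le_one_left (norm_nonneg _) (norm_transplant_le hx a u)
  rw [← (hs _).tsum_sub (hs _), tsum_eq_single (x i)]
  · rw [transplant_apply hx, transplant_apply hx, Function.update_self, Function.update_self,
      sub_mul]
  · intro u hu
    by_cases hu' : ∃ j, x j = u
    · obtain ⟨j, rfl⟩ := hu'
      have hj : y j ≠ y i := fun h => hu (congrArg x (hy h))
      rw [transplant_apply hx, transplant_apply hx, Function.update_of_ne hj,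
        Function.update_of_ne hj, sub_self]
    · rw [transplant_apply' _ hu', transplant_apply' _ hu', sub_self]

theorem isOpen_exists_lt_norm_tsum (hx : x.Injective) {b : ι → X → ℂ}
    (hb : ∀ i, Summable fun u => ‖b i u‖) (B : Set ι) (ε : ℝ) :
    IsOpen {a : Y → Disk | ∃ i ∈ B, ε < ‖∑' u, transplant x y a u * b i u‖} := by
  have h : {a : Y → Disk | ∃ i ∈ B, ε < ‖∑' u, transplant x y a u * b i u‖} =
      ⋃ i ∈ B, {a | ε < ‖∑' u, transplant x y a u * b i u‖} := by
    ext
    simp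
  rw [h]
  exact isOpen_biUnion fun i _ =>
    isOpen_lt continuous_const (continuous_tsum_transplant hx (hb i)).norm

/-- A basic open set restricts finitely many coordinates, so some `i ∈ B` has `y i` free. Moving
that coordinate from 0 to 1 changes the series by `b i (x i)`, of modulus above 2ε, so one of the
two values exceeds ε. -/
theorem dense_exists_lt_norm_tsum (hx : x.Injective) (hy : y.Injective) {b : ι → X → ℂ}
    (hb : ∀ i, Summable fun u => ‖b i u‖) {B : Set ι} (hB : B.Infinite) {ε : ℝ}
    (hε : ∀ i, 2 * ε < ‖b i (x i)‖) :
    Dense {a : Y → Disk | ∃ i ∈ B, ε < ‖∑' u, transplant x y a u * b i u‖} := by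
  classical
  rw [dense_iff_inter_open]
  rintro U hU ⟨a, ha⟩
  obtain ⟨I, W, hW, hWU⟩ := isOpen_pi_iff.1 hU a ha
  obtain ⟨i, hiB, hiI⟩ : ∃ i ∈ B, y i ∉ I := by
    by_contra! hc
    exact hB ((I.finite_toSet.preimage hy.injOn).subset fun i hi => hc i hi)
  have hmem : ∀ t, Function.update a (y i) t ∈ U := fun t => hWU fun z hz => by
    have hzi : z ≠ y i := fun h => hiI (h ▸ hz)
    rw [Function.update_of_ne hzi]
    exact (hW z hz).2
  by_contra hne
  have hle : ∀ t, ‖∑' u, transplant x y (Function.update a (y i) t) u * b i u‖ ≤ ε := fun t => by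
    by_contra! hc
    exact hne ⟨_, hmem t, i, hiB, hc⟩
  have h := tsum_transplant_update hx hy (hb i) a i ⟨1, by simp⟩ ⟨0, by simp⟩
  have h' := norm_sub_le (∑' u, transplant x y (Function.update a (y i) ⟨1, by simp⟩) u * b i u)
    (∑' u, transplant x y (Function.update a (y i) ⟨0, by simp⟩) u * b i u)
  rw [h, sub_zero, one_mul] at h'
  linarith [hle ⟨1, by simp⟩, hle ⟨0, by simp⟩, hε i]

end Transplant

variable (Φ : 𝓔.uniformRoeAlgebra ≃⋆ₐ[ℂ] 𝓕.uniformRoeAlgebra)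

/-- The multipliers are indexed by `Y` rather than `X`, so that the smallness hypothesis on 𝓕
controls both the parameter space and the number of generators. Injectivity of `y'` plays no role,
as it only selects matrix entries. -/
theorem range_mem_of_injective (h𝓕 : 𝓕.UniformlyLocallyFinite) (hsp : 𝓕.HasSmallPartition)
    {δ : ℝ} (hδ : 0 < δ) {E : Set (X × X)} (hE : E ∈ 𝓔.entourages) {ι : Type*} {x x' : ι → X}
    {y y' : ι → Y} (hx : x.Injective) (hx' : x'.Injective) (hy : y.Injective)
    (hxE : ∀ i, (x i, x' i) ∈ E) (h₁ : ∀ i, δ ≤ ‖vec Φ (x i) (y i)‖)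
    (h₂ : ∀ i, δ ≤ ‖vec Φ (x' i) (y' i)‖) :
    Set.range (fun i => (y i, y' i)) ∈ 𝓕.entourages := by
  obtain ⟨r, hsmall, hgen⟩ := hsp
  obtain ⟨S, hS, hcard⟩ := (𝓕.blockDiagonal r).exists_generators
  obtain ⟨V, hV⟩ := exists_partialTranslation hx hx' hE hxE
  set ΦV : EllTwo Y →L[ℂ] EllTwo Y := (Φ V : EllTwo Y →L[ℂ] EllTwo Y) with hΦV
  set b : ι → X → ℂ := fun i u => inner ℂ (delta (y' i)) (ΦV (vec Φ u)) *
    inner ℂ (vec Φ u) (delta (y i)) with hb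
  have hbs : ∀ i, Summable fun u => ‖b i u‖ := fun i => by
    have h := summable_norm_inner_mul_inner Φ (delta (y i)) (ContinuousLinearMap.adjoint ΦV (delta (y' i)))
    simpa only [ContinuousLinearMap.adjoint_inner_left] using h
  have hbi : ∀ i, δ ^ 2 ≤ ‖b i (x i)‖ := fun i => by
    obtain ⟨c, hc, hcV⟩ := exists_map_vec_eq Φ V (hV i)
    rw [hb]
    simp only [hΦV, hcV]
    rw [inner_smul_right, inner_delta, ← inner_conj_symm (vec Φ (x i)), inner_delta, norm_mul,
      norm_mul, hc, one_mul, RCLike.norm_conj, sq]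
    exact mul_le_mul (h₂ i) (h₁ i) hδ.le (norm_nonneg _)
  have hcoeff : ∀ (a : Y → Disk) (i : ι),
      coeff (Φ (V * 𝓔.mulR (transplant x y a) (norm_transplant_le hx a)) : EllTwo Y →L[ℂ] EllTwo Y)
        (y i) (y' i) = ∑' u, transplant x y a u * b i u := fun a i => by
    have h := hasSum_inner_map_mulR Φ (transplant x y a) (norm_transplant_le hx a) (delta (y i))
      (ContinuousLinearMap.adjoint ΦV (delta (y' i)))
    simp only [ContinuousLinearMap.adjoint_inner_left] at h
    rw [h.tsum_eq, coeff, map_mul, coeR_mul, mul_apply_eq_comp]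
  -- Finite sets of pairs need not be entourages in general; these are, since a member of the
  -- algebra has a nonzero coefficient there.
  have hsingle : ∀ i, {(y i, y' i)} ∈ 𝓕.entourages := fun i => by
    refine 𝓕.singleton_mem_of_coeff_ne_zero (Φ (V * 𝓔.projR (x i))).2 ?_
    rw [coeff, map_mul, coeR_mul, mul_apply_eq_comp, coe_map_projR,
      InnerProductSpace.rankOne_apply, map_smul, inner_smul_right, mul_comm]
    exact norm_pos_iff.1 ((by positivity : 0 < δ ^ 2).trans_le (hbi i))
  suffices hL : ∃ L : List S, {i | ¬ Chain (L.map Subtype.val) (y i) (y' i)}.Finite by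
    obtain ⟨L, hL⟩ := hL
    have hD : {p : Y × Y | Chain (L.map Subtype.val) p.1 p.2} ∈ 𝓕.entourages := by
      refine chain_mem fun s hs => ?_
      obtain ⟨s, -, rfl⟩ := List.mem_map.1 hs
      have hs' : (s : Set (Y × Y)) ∈ (𝓕.blockDiagonal r).entourages :=
        hS ▸ subset_generate S s.2
      obtain ⟨F, hF, hsF⟩ := hs'
      exact hsF ▸ 𝓕.subset_mem F hF _ Set.inter_subset_right
    refine 𝓕.subset_mem _ (𝓕.union_mem _ hD _ (finite_mem (hL.image fun i => (y i, y' i)) ?_)) _ ?_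
    · rintro _ ⟨i, -, rfl⟩
      exact hsingle i
    · rintro _ ⟨i, rfl⟩
      by_cases hi : Chain (L.map Subtype.val) (y i) (y' i)
      · exact Or.inl hi
      · exact Or.inr ⟨i, hi, rfl⟩
  by_contra! hinf
  have hinf' : ∀ L : List S, {i | ¬ Chain (L.map Subtype.val) (y i) (y' i)}.Infinite := hinf
  set e := fun L => (hinf' L).natEmbedding with he
  -- The list handles the block-diagonal part of an entourage; the tail from `q.2` on gets past its
  -- finite off-block part. The threshold δ²/3 leaves room for 2ε < δ² ≤ |b_i(x_i)|.
  set U : List S × ℕ → Set (Y → Disk) := fun q => {a | ∃ i ∈ (fun k => (e q.1 k : ι)) '' Set.Ici q.2,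
    δ ^ 2 / 3 < ‖∑' u, transplant x y a u * b i u‖} with hU
  have hcardι : #(List S × ℕ) ≤ max ℵ₀ (𝓕.blockDiagonal r).minGenerators := by
    rw [hcard, Cardinal.mk_prod, Cardinal.lift_uzero, Cardinal.mk_nat, Cardinal.lift_aleph0]
    refine (Cardinal.mul_le_max_of_aleph0_le_right le_rfl).trans ?_
    exact max_le (Cardinal.mk_list_le_max _) (le_max_left _ _)
  obtain ⟨a, ha⟩ := iInter_nonempty_of_card_lt_cov hsmall hcardι U
    (fun q => isOpen_exists_lt_norm_tsum hx hbs _ _)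
    (fun q => dense_exists_lt_norm_tsum hx hy hbs
      ((Set.Ici_infinite q.2).image fun k _ k' _ h => (e q.1).injective (Subtype.ext h))
      fun i => by linarith [hbi i, (by positivity : 0 < δ ^ 2)])
  rw [Set.mem_iInter] at ha
  obtain ⟨F, hF, hFa⟩ := 𝓕.exists_entourage_coeff_lt
    (Φ (V * 𝓔.mulR (transplant x y a) (norm_transplant_le hx a))).2
    (by positivity : 0 < δ ^ 2 / 3)
  obtain ⟨L, hL⟩ := exists_chain_of_mem_generate (S := S)
    (E := {p : Y × Y | r p.1 p.2} ∩ F) (by rw [hS]; exact ⟨F, hF, rfl⟩)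
  have hfin := finite_diff_of_generate h𝓕 hgen hF
  have hinj : Function.Injective fun k => (y (e L k), y' (e L k)) := fun k k' h =>
    (e L).injective (Subtype.ext (hy (congrArg Prod.fst h)))
  -- Beyond `n` every pair that lies in `F` is within a block, hence joined by a chain along `L`,
  -- contrary to the choice of `e L`.
  obtain ⟨n, hn⟩ := (hfin.preimage hinj.injOn).bddAbove
  obtain ⟨_, ⟨k, hk, rfl⟩, hlt⟩ := ha (L, n + 1)
  refine absurd hlt (not_lt.2 ?_)
  rw [← hcoeff]
  refine (hFa _ _ fun hmem => ?_).le
  by_cases hr : r (y (e L k)) (y' (e L k))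
  · exact (e L k).2 (hL _ _ ⟨hr, hmem⟩)
  · have h3 : k ≤ n := hn ⟨hmem, hr⟩
    have h4 : n + 1 ≤ k := hk
    omega

end CoarseStructure

theorem encard_biUnion_le_mul {α β : Type*} {s : Set α} {t : α → Set β} {m n : ℕ}
    (hs : s.encard ≤ m) (ht : ∀ a, (t a).encard ≤ n) :
    (⋃ a ∈ s, t a).encard ≤ (m * n : ℕ) := by
  have hfin : s.Finite := Set.finite_of_encard_le_coe hs
  lift s to Finset α using hfin
  rw [Set.encard_coe_eq_coe_finsetCard] at hs
  have h := Finset.set_encard_biUnion_le s t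
  simp only [Finset.mem_coe]
  refine h.trans ((Finset.sum_le_card_nsmul s (fun a => (t a).encard) n fun a _ => ht a).trans ?_)
  rw [nsmul_eq_mul]
  push_cast
  gcongr

namespace CoarseStructure

variable {X : Type u} {Y : Type v} {𝓔 : CoarseStructure X} {𝓕 : CoarseStructure Y}

/-! ### Rigidity -/

theorem exists_encard_le_of_sum_sq_le {ι : Type*} {f : ι → ℝ}
    (hf : ∀ s : Finset ι, ∑ i ∈ s, f i ^ 2 ≤ 1) {δ : ℝ} (hδ : 0 < δ) :
    {i | δ ≤ f i}.encard ≤ (⌊1 / δ ^ 2⌋₊ : ℕ) := by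
  refine Set.encard_le_coe_iff_finite_ncard_le.2 ?_
  have hcard : ∀ s : Finset ι, ↑s ⊆ {i | δ ≤ f i} → s.card ≤ ⌊1 / δ ^ 2⌋₊ := fun s hs => by
    rw [Nat.le_floor_iff (by positivity), le_div_iff₀ (by positivity)]
    refine le_trans ?_ (hf s)
    rw [← nsmul_eq_mul]
    exact Finset.card_nsmul_le_sum s _ _ fun i hi => pow_le_pow_left₀ hδ.le (hs hi) 2
  have hfin : {i | δ ≤ f i}.Finite := by
    by_contra hinf
    obtain ⟨s, hs, hs'⟩ := Set.Infinite.exists_subset_card_eq hinf (⌊1 / δ ^ 2⌋₊ + 1)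
    have := hcard s hs
    omega
  refine ⟨hfin, ?_⟩
  rw [Set.ncard_eq_toFinset_card _ hfin]
  exact hcard _ (by simp)

theorem UniformlyLocallyFinite.symm (h𝓔 : 𝓔.UniformlyLocallyFinite) {E : Set (X × X)}
    (hE : E ∈ 𝓔.entourages) : ∃ n : ℕ, ∀ y, {x | (x, y) ∈ E}.encard ≤ n :=
  h𝓔 _ (𝓔.inv_mem E hE)

variable (Φ : 𝓔.uniformRoeAlgebra ≃⋆ₐ[ℂ] 𝓕.uniformRoeAlgebra)

theorem range_mem_of_colouring (h𝓕 : 𝓕.UniformlyLocallyFinite) (hsp : 𝓕.HasSmallPartition)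
    {δ : ℝ} (hδ : 0 < δ) {E : Set (X × X)} (hE : E ∈ 𝓔.entourages) {ι κ : Type*} [Fintype κ]
    (c : ι → κ) {x x' : ι → X} {y y' : ι → Y} (hx : ∀ i j, c i = c j → x i = x j → i = j)
    (hx' : ∀ i j, c i = c j → x' i = x' j → i = j) (hy : ∀ i j, c i = c j → y i = y j → i = j)
    (hxE : ∀ i, (x i, x' i) ∈ E) (h₁ : ∀ i, δ ≤ ‖vec Φ (x i) (y i)‖)
    (h₂ : ∀ i, δ ≤ ‖vec Φ (x' i) (y' i)‖) :
    Set.range (fun i => (y i, y' i)) ∈ 𝓕.entourages := by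
  classical
  have hclass : ∀ k, Set.range (fun i : {i // c i = k} => (y i, y' i)) ∈ 𝓕.entourages := fun k =>
    range_mem_of_injective Φ h𝓕 hsp hδ hE (x := fun i : {i // c i = k} => x i)
      (x' := fun i => x' i) (y := fun i => y i) (y' := fun i => y' i)
      (fun i j h => Subtype.ext (hx _ _ (i.2.trans j.2.symm) h))
      (fun i j h => Subtype.ext (hx' _ _ (i.2.trans j.2.symm) h))
      (fun i j h => Subtype.ext (hy _ _ (i.2.trans j.2.symm) h))
      (fun i => hxE i) (fun i => h₁ i) (fun i => h₂ i)
  have hunion : ∀ (t : Finset κ) (F : κ → Set (Y × Y)), (∀ k, F k ∈ 𝓕.entourages) →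
      (⋃ k ∈ t, F k) ∈ 𝓕.entourages := fun t F hF => by
    induction t using Finset.induction_on with
    | empty => exact 𝓕.subset_mem _ 𝓕.diag_mem _ (by simp)
    | insert k t _ ih =>
      rw [Finset.set_biUnion_insert]
      exact 𝓕.union_mem _ (hF k) _ ih
  refine 𝓕.subset_mem _ (hunion Finset.univ _ hclass) _ ?_
  rintro _ ⟨i, rfl⟩
  exact Set.mem_iUnion₂.2 ⟨c i, Finset.mem_univ _, ⟨i, rfl⟩, rfl⟩

/-- By Chebyshev each x is related to at most ⌊1/δ²⌋ points y and conversely. With uniform local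
finiteness, the maps from admissible quadruples (x, x', y, y') to x, x' and y have bounded fibres,
and a product of three colourings makes all three injective on each class. -/
theorem near_mem (h𝓔 : 𝓔.UniformlyLocallyFinite) (h𝓕 : 𝓕.UniformlyLocallyFinite)
    (hsp : 𝓕.HasSmallPartition) {δ : ℝ} (hδ : 0 < δ) {E : Set (X × X)} (hE : E ∈ 𝓔.entourages) :
    {p : Y × Y | ∃ x x', (x, x') ∈ E ∧ δ ≤ ‖vec Φ x p.1‖ ∧ δ ≤ ‖vec Φ x' p.2‖} ∈ 𝓕.entourages := by
  obtain ⟨m, hm⟩ := h𝓔 E hE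
  obtain ⟨m', hm'⟩ := h𝓔.symm hE
  set N := ⌊1 / δ ^ 2⌋₊
  have hX : ∀ y, {x | δ ≤ ‖vec Φ x y‖}.encard ≤ N := fun y =>
    exists_encard_le_of_sum_sq_le (fun s => sum_le_hasSum s (fun _ _ => by positivity)
      (hasSum_norm_vec_sq Φ y)) hδ
  have hY : ∀ x, {y | δ ≤ ‖vec Φ x y‖}.encard ≤ N := fun x =>
    exists_encard_le_of_sum_sq_le (fun s => (sum_le_hasSum s (fun _ _ => by positivity)
      (hasSum_norm_sq (vec Φ x))).trans_eq (by rw [norm_vec, one_pow])) hδ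
  let Q := {q : X × X × Y × Y // (q.1, q.2.1) ∈ E ∧ δ ≤ ‖vec Φ q.1 q.2.2.1‖ ∧
    δ ≤ ‖vec Φ q.2.1 q.2.2.2‖}
  have hfib : ∀ (s : Set Q) (n : ℕ) (t : Set (X × X × Y × Y)), t.encard ≤ n →
      (∀ q ∈ s, (q : X × X × Y × Y) ∈ t) → s.encard ≤ n := fun s n t ht hst => by
    rw [← Subtype.val_injective.encard_image s]
    refine (Set.encard_le_encard ?_).trans ht
    rintro _ ⟨q, hq, rfl⟩
    exact hst q hq
  obtain ⟨n₁, c₁, hc₁⟩ := exists_colouring (fun q : Q => q.1.1) (m * (N * (N * 1))) fun x => by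
    refine hfib _ _ (⋃ x' ∈ {x' | (x, x') ∈ E}, ⋃ y ∈ {y | δ ≤ ‖vec Φ x y‖},
      ⋃ y' ∈ {y' | δ ≤ ‖vec Φ x' y'‖}, {(x, x', y, y')})
      (encard_biUnion_le_mul (hm x) fun x' => encard_biUnion_le_mul (hY x) fun y =>
        encard_biUnion_le_mul (hY x') fun y' => by simp) ?_
    rintro ⟨⟨x, x', y, y'⟩, h, h₁, h₂⟩ rfl
    simp only [Set.mem_iUnion]
    exact ⟨x', h, y, h₁, y', h₂, rfl⟩
  obtain ⟨n₂, c₂, hc₂⟩ := exists_colouring (fun q : Q => q.1.2.1) (m' * (N * (N * 1))) fun x' => by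
    refine hfib _ _ (⋃ x ∈ {x | (x, x') ∈ E}, ⋃ y ∈ {y | δ ≤ ‖vec Φ x y‖},
      ⋃ y' ∈ {y' | δ ≤ ‖vec Φ x' y'‖}, {(x, x', y, y')})
      (encard_biUnion_le_mul (hm' x') fun x => encard_biUnion_le_mul (hY x) fun y =>
        encard_biUnion_le_mul (hY x') fun y' => by simp) ?_
    rintro ⟨⟨x, x', y, y'⟩, h, h₁, h₂⟩ rfl
    simp only [Set.mem_iUnion]
    exact ⟨x, h, y, h₁, y', h₂, rfl⟩
  obtain ⟨n₃, c₃, hc₃⟩ := exists_colouring (fun q : Q => q.1.2.2.1) (N * (m * (N * 1))) fun y => by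
    refine hfib _ _ (⋃ x ∈ {x | δ ≤ ‖vec Φ x y‖}, ⋃ x' ∈ {x' | (x, x') ∈ E},
      ⋃ y' ∈ {y' | δ ≤ ‖vec Φ x' y'‖}, {(x, x', y, y')})
      (encard_biUnion_le_mul (hX y) fun x => encard_biUnion_le_mul (hm x) fun x' =>
        encard_biUnion_le_mul (hY x') fun y' => by simp) ?_
    rintro ⟨⟨x, x', y, y'⟩, h, h₁, h₂⟩ rfl
    simp only [Set.mem_iUnion]
    exact ⟨x, h₁, x', h, y', h₂, rfl⟩
  refine 𝓕.subset_mem _ (range_mem_of_colouring Φ h𝓕 hsp hδ hE (fun q => (c₁ q, c₂ q, c₃ q))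
    (x := fun q : Q => q.1.1) (x' := fun q => q.1.2.1) (y := fun q => q.1.2.2.1)
    (y' := fun q => q.1.2.2.2)
    (fun q q' h => hc₁ q q' (congrArg Prod.fst h))
    (fun q q' h => hc₂ q q' (congrArg (fun k => k.2.1) h))
    (fun q q' h => hc₃ q q' (congrArg (fun k => k.2.2) h))
    (fun q => q.2.1) (fun q => q.2.2.1) (fun q => q.2.2.2)) _ ?_
  rintro ⟨y, y'⟩ ⟨x, x', h, h₁, h₂⟩
  exact ⟨⟨(x, x', y, y'), h, h₁, h₂⟩, rfl⟩

/-- Both `f` and `g` select related points, so transporting entourages through the relation gives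
all four control conditions. Closeness is transport of the diagonal: x and g(f(x)) are both related
to f(x), and symmetrically for y. -/
theorem coarselyEquivalent_of_starAlgEquiv
    (Φ : 𝓔.uniformRoeAlgebra ≃⋆ₐ[ℂ] 𝓕.uniformRoeAlgebra) (h𝓔 : 𝓔.UniformlyLocallyFinite)
    (h𝓕 : 𝓕.UniformlyLocallyFinite) (hs𝓔 : 𝓔.HasSmallPartition) (hs𝓕 : 𝓕.HasSmallPartition)
    (hg𝓔 : 𝓔.GhostProjectionsCompact) (hg𝓕 : 𝓕.GhostProjectionsCompact) :
    CoarselyEquivalent 𝓔 𝓕 := by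
  obtain ⟨δ₁, hδ₁, hf⟩ := exists_lower_bound_of_ghostProjectionsCompact Φ hg𝓕
  obtain ⟨δ₂, hδ₂, hg⟩ := exists_lower_bound_of_ghostProjectionsCompact Φ.symm hg𝓔
  simp only [norm_vec_symm] at hg
  choose f hf using hf
  choose g hg using hg
  set δ := min δ₁ δ₂
  have hδ : 0 < δ := lt_min hδ₁ hδ₂
  replace hf : ∀ x, δ ≤ ‖vec Φ x (f x)‖ := fun x => (min_le_left _ _).trans (hf x)
  replace hg : ∀ y, δ ≤ ‖vec Φ (g y) y‖ := fun y => (min_le_right _ _).trans (hg y)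
  have hXY : ∀ E ∈ 𝓔.entourages, {p : Y × Y | ∃ x x', (x, x') ∈ E ∧ δ ≤ ‖vec Φ x p.1‖ ∧
      δ ≤ ‖vec Φ x' p.2‖} ∈ 𝓕.entourages := fun E hE => near_mem Φ h𝓔 h𝓕 hs𝓕 hδ hE
  have hYX : ∀ F ∈ 𝓕.entourages, {p : X × X | ∃ y y', (y, y') ∈ F ∧ δ ≤ ‖vec Φ p.1 y‖ ∧
      δ ≤ ‖vec Φ p.2 y'‖} ∈ 𝓔.entourages := fun F hF => by
    simpa only [norm_vec_symm] using near_mem Φ.symm h𝓕 h𝓔 hs𝓔 hδ hF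
  refine ⟨f, ⟨fun E hE => ⟨_, hXY E hE, fun x x' h => ⟨x, x', h, hf x, hf x'⟩⟩,
    fun F hF => ⟨_, hYX F hF, fun x x' h h' => h ⟨f x, f x', h', hf x, hf x'⟩⟩⟩, g,
    fun F hF => ⟨_, hYX F hF, fun y y' h => ⟨y, y', h, hg y, hg y'⟩⟩, ?_, ?_⟩
  · refine 𝓔.subset_mem _ (hYX _ 𝓕.diag_mem) _ ?_
    rintro _ ⟨x, rfl⟩
    exact ⟨f x, f x, rfl, hg (f x), hf x⟩
  · refine 𝓕.subset_mem _ (hXY _ 𝓔.diag_mem) _ ?_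
    rintro _ ⟨y, rfl⟩
    exact ⟨g y, g y, rfl, hf (g y), hg y⟩

end CoarseStructure

end

theorem mainTheorem10 (X : Type u) (Y : Type v) :
    (∀ (𝓔 : CoarseStructure X) (𝓕 : CoarseStructure Y),
      𝓔.UniformlyLocallyFinite → 𝓕.UniformlyLocallyFinite →
      𝓔.HasSmallPartition → 𝓕.HasSmallPartition →
      𝓔.GhostProjectionsCompact → 𝓕.GhostProjectionsCompact →
      Nonempty (𝓔.uniformRoeAlgebra ≃⋆ₐ[ℂ] 𝓕.uniformRoeAlgebra) →
      CoarseStructure.CoarselyEquivalent 𝓔 𝓕) ∧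
    (∀ [MetricSpace X] [MetricSpace Y],
      (CoarseStructure.bounded X).UniformlyLocallyFinite →
      (CoarseStructure.bounded Y).UniformlyLocallyFinite →
      (CoarseStructure.bounded X).GhostProjectionsCompact →
      (CoarseStructure.bounded Y).GhostProjectionsCompact →
      Nonempty ((CoarseStructure.bounded X).uniformRoeAlgebra ≃⋆ₐ[ℂ]
        (CoarseStructure.bounded Y).uniformRoeAlgebra) →
      CoarseStructure.CoarselyEquivalent (CoarseStructure.bounded X)
        (CoarseStructure.bounded Y)) := by
  refine ⟨fun 𝓔 𝓕 h𝓔 h𝓕 hs𝓔 hs𝓕 hg𝓔 hg𝓕 ⟨Φ⟩ =>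
    CoarseStructure.coarselyEquivalent_of_starAlgEquiv Φ h𝓔 h𝓕 hs𝓔 hs𝓕 hg𝓔 hg𝓕, ?_⟩
  intro _ _ hX hY hgX hgY ⟨Φ⟩
  exact CoarseStructure.coarselyEquivalent_of_starAlgEquiv Φ hX hY
    (CoarseStructure.hasSmallPartition_bounded X) (CoarseStructure.hasSmallPartition_bounded Y)
    hgX hgY
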